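/- \textbf{Setting.} Let $d\in\{1,2\}$, let $\Omega\subset\mathbb{R}^d$ be a bounded Lipschitz domain, $T>0$ and $Q_T=\Omega\times(0,T)$. Let $\mathbf v\in C([0,T];C^2(\Omega)^d)$ satisfy $\nabla\cdot\mathbf v=0$ in $\Omega\times[0,T]$, where $C^2(\Omega)$ carries the supremum norms of the derivatives up to order two. For each $t\in[0,T]$ let $\Omega$ be the disjoint union of two open sets $\Omega_1(t),\Omega_2(t)$ and the interface $\Gamma(t)=\partial\Omega_1(t)\cap\partial\Omega_2(t)$, with $\Gamma(t)\cap\partial\Omega=\varnothing$, where $\Gamma(t)$ is transported by $\mathbf v$. Assume that the sets $Q_i=\bigcup_{t\in(0,T)}\Omega_i(t)\times\{t\}$ $(i=1,2)$ are open in $\mathbb{R}^{d+1}$ and that $\Gamma^\ast=\bigcup_{t\in(0,T)}\Gamma(t)\times\{t\}$ is a $C^2$-regular hypersurface in $\mathbb{R}^{d+1}$. Let $\kappa=\kappa_i$ in $Q_i$ with constants $\kappa_1,\kappa_2>0$. Let $\omega$ be a nonempty subdomain (open and connected) with $\omega\subset\Omega_2(t)$ for all $t\in[0,T]$, and $\omega_T=\omega\times(0,T)$.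 Let $Y=H^{1,0}_0(Q_T)$ be the closure of $C^1_0(Q_T)$ in the norm $(\|v\|^2_{L^2(Q_T)}+\|\nabla v\|^2_{L^2(Q_T)})^{1/2}$, where $\nabla$ is the gradient in $x$; let $X=\{v\in Y:\partial_t v\in Y'\}$ and $X_0=\{v\in X: v(\cdot,0)=0\}$, where $v(\cdot,0)$ is taken from the representative of $v$ in $C([0,T];L^2(\Omega))$. For $u\in X$, $\varphi\in Y$ put $$a(u,\varphi)=\langle\partial_t u,\varphi\rangle+\int_0^T\!\!\int_\Omega(\mathbf v\cdot\nabla u)\,\varphi+\kappa\nabla u\cdot\nabla\varphi\,dx\,dt .$$ Let $\ell\in L^\infty(Q_T)$ with $\ell\ge L$ a.e. for a constant $L>0$, let $g\in L^2(Q_T)$ with $g\ge0$ a.e., and let $U_d,U_d^\varepsilon\in L^2(\omega_T)$ with $\|U_d^\varepsilon-U_d\|_{L^2(\omega_T)}\le\varepsilon$, $\varepsilon>0$. Put $F_+=\{f\in L^2(Q_T): f\ge 0\text{ a.e. in }Q_T\}$. \textbf{Theorem.} For every $F\in L^2(Q_T)$ there is exactly one $u\in X_0$ with $a(u,\varphi)=(F,\varphi)_{L^2(Q_T)}$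 for all $\varphi\in Y$; denote it by $S(F)$, and put $u(f)=S(\ell f)$ for $f\in L^2(Q_T)$, $u^\ast=S(g)$ and $z_d^\varepsilon=U_d^\varepsilon-u^\ast|_{\omega_T}$. For every $\lambda>0$ the problem $$\min_{f\in F_+}\ \tfrac12\|u(f)-z_d^\varepsilon\|^2_{L^2(\omega_T)}+\tfrac{\lambda}{2}\|f\|^2_{L^2(Q_T)}$$ has a unique solution $f_\lambda^\varepsilon\in F_+$. -/

import Mathlib

open MeasureTheory Set Filter Topology
open scoped ENNReal Distributions

noncomputable section

namespace AdvDiff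

/-- The Euclidean space `ℝ^d`. -/
abbrev Space (d : ℕ) : Type := EuclideanSpace ℝ (Fin d)

/-- Points `(x, t)` of space-time `ℝ^d × ℝ`. -/
abbrev SpaceTime (d : ℕ) : Type := Space d × ℝ

/-- The boundary of `Ω` is locally the graph of a Lipschitz function: near each boundary point,
`Ω` lies strictly above such a graph in the direction of some unit vector `e`. The function `ψ`
is only evaluated on the hyperplane orthogonal to `e`. -/
def HasLipschitzBoundary {d : ℕ} (Ω : Set (Space d)) : Prop :=
  ∀ x ∈ frontier Ω, ∃ e : Space d, ‖e‖ = 1 ∧ ∃ (K : NNReal) (ψ : Space d → ℝ), LipschitzWith K ψ ∧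
    ∃ r > 0, ∀ y ∈ Metric.ball x r, (y ∈ Ω ↔ ψ (y - inner ℝ e y • e) < inner ℝ e y)

/-- `M` is a `C²`-regular hypersurface: locally the zero set of a `C²` function without critical
points. -/
def IsC2Hypersurface {V : Type*} [NormedAddCommGroup V] [NormedSpace ℝ V] (M : Set V) : Prop :=
  ∀ p ∈ M, ∃ U : Set V, IsOpen U ∧ p ∈ U ∧ ∃ φ : V → ℝ, ContDiffOn ℝ 2 φ U ∧
    (∀ q ∈ U, fderiv ℝ φ q ≠ 0) ∧ M ∩ U = {q | q ∈ U ∧ φ q = 0}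

/-- `v ∈ C([0,T]; C²(Ω)^d)`, where `C²(Ω)` carries the supremum norms of the derivatives of order
at most two (which are therefore bounded). Here `v t x` is the velocity at time `t`, place `x`. -/
def IsContinuousC2Field {d : ℕ} (Ω : Set (Space d)) (T : ℝ) (v : ℝ → Space d → Space d) : Prop :=
  ∀ t ∈ Icc 0 T, ContDiffOn ℝ 2 (v t) Ω ∧ ∀ k ≤ 2,
    (∃ C : ℝ, ∀ x ∈ Ω, ‖iteratedFDeriv ℝ k (v t) x‖ ≤ C) ∧
    TendstoUniformlyOn (fun s x => iteratedFDeriv ℝ k (v s) x) (iteratedFDeriv ℝ k (v t))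
      (𝓝[Icc 0 T] t) Ω

/-- The divergence of a vector field. -/
def divergence {d : ℕ} (w : Space d → Space d) (x : Space d) : ℝ :=
  LinearMap.trace ℝ (Space d) (fderiv ℝ w x : Space d →ₗ[ℝ] Space d)

/-- The interface between two open sets: their common boundary. -/
def interface {d : ℕ} (A B : Set (Space d)) : Set (Space d) := frontier A ∩ frontier B

/-- The space-time set `⋃_{t ∈ (0,T)} A(t) × {t}`. -/
def tube {d : ℕ} (A : ℝ → Set (Space d)) (T : ℝ) : Set (SpaceTime d) :=
  {p | p.2 ∈ Ioo 0 T ∧ p.1 ∈ A p.2}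

/-- The geometric data: a bounded Lipschitz domain `Ω`, split for each `t ∈ [0,T]` into two open
sets `Ω₁ t`, `Ω₂ t` by an interface `Γ t = ∂(Ω₁ t) ∩ ∂(Ω₂ t)` which does not meet `∂Ω` and is
transported by a divergence-free velocity field `v`, and a fixed observation subdomain `ω`. -/
structure MovingDomain (d : ℕ) where
  Ω : TopologicalSpace.Opens (Space d)
  connected : IsConnected (Ω : Set (Space d))
  bounded : Bornology.IsBounded (Ω : Set (Space d))
  lipschitz : HasLipschitzBoundary (Ω : Set (Space d))
  T : ℝ
  T_pos : 0 < T
  v : ℝ → Space d → Space d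
  v_regular : IsContinuousC2Field (Ω : Set (Space d)) T v
  v_div : ∀ t ∈ Icc 0 T, ∀ x ∈ Ω, divergence (v t) x = 0
  Ω₁ : ℝ → Set (Space d)
  Ω₂ : ℝ → Set (Space d)
  isOpen₁ : ∀ t ∈ Icc 0 T, IsOpen (Ω₁ t)
  isOpen₂ : ∀ t ∈ Icc 0 T, IsOpen (Ω₂ t)
  disjoint : ∀ t ∈ Icc 0 T, Disjoint (Ω₁ t) (Ω₂ t)
  split : ∀ t ∈ Icc 0 T, (Ω : Set (Space d)) = Ω₁ t ∪ Ω₂ t ∪ interface (Ω₁ t) (Ω₂ t)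
  interface_boundary :
    ∀ t ∈ Icc 0 T, Disjoint (interface (Ω₁ t) (Ω₂ t)) (frontier (Ω : Set (Space d)))
  /-- Each point of the interface moves along an integral curve of `v` that stays on the
  interface during the whole time interval. -/
  transported : ∀ t₀ ∈ Icc 0 T, ∀ x₀ ∈ interface (Ω₁ t₀) (Ω₂ t₀),
    ∃ X : ℝ → Space d, X t₀ = x₀ ∧ ∀ t ∈ Icc 0 T,
      X t ∈ interface (Ω₁ t) (Ω₂ t) ∧ HasDerivWithinAt X (v t (X t)) (Icc 0 T) t
  /-- The sets `Q₁` and `Q₂` are open in space-time. -/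
  isOpen_tube₁ : IsOpen (tube Ω₁ T)
  isOpen_tube₂ : IsOpen (tube Ω₂ T)
  hypersurface : IsC2Hypersurface (tube (fun t => interface (Ω₁ t) (Ω₂ t)) T)
  ω : Set (Space d)
  ω_isOpen : IsOpen ω
  ω_connected : IsConnected ω
  ω_subset : ∀ t ∈ Icc 0 T, ω ⊆ Ω₂ t

/-- The spatial gradient `∇φ` of a function on space-time. -/
def spaceGrad {d : ℕ} (φ : SpaceTime d → ℝ) (p : SpaceTime d) : Space d :=
  gradient (fun x => φ (x, p.2)) p.1

/-- The time derivative `∂ₜφ` of a function on space-time. -/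
def timeDiff {d : ℕ} (φ : SpaceTime d → ℝ) (p : SpaceTime d) : ℝ :=
  deriv (fun s => φ (p.1, s)) p.2

/-- The space `L²(A)` of real functions on a space-time set `A`. -/
abbrev L2 {d : ℕ} (A : Set (SpaceTime d)) : Type :=
  Lp ℝ 2 ((volume : Measure (SpaceTime d)).restrict A)

/-- The space `L²(A; ℝ^d)` of vector fields on a space-time set `A`. -/
abbrev L2Vec {d : ℕ} (A : Set (SpaceTime d)) : Type :=
  Lp (Space d) 2 ((volume : Measure (SpaceTime d)).restrict A)

/-- Restriction of functions `L²(B) → L²(A)` for `A ⊆ B`. -/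
def restrictL2 {d : ℕ} {A B : Set (SpaceTime d)} (h : A ⊆ B) (u : L2 B) : L2 A :=
  ((Lp.memLp u).mono_measure (Measure.restrict_mono h le_rfl)).toLp u

theorem spaceGrad_eq {d : ℕ} {φ : SpaceTime d → ℝ} (h : ContDiff ℝ 1 φ) (p : SpaceTime d) :
    spaceGrad φ p = (InnerProductSpace.toDual ℝ (Space d)).symm
      ((fderiv ℝ φ p).comp (ContinuousLinearMap.inl ℝ (Space d) ℝ)) := by
  have h1 : HasFDerivAt φ (fderiv ℝ φ p) ((fun x : Space d => (x, p.2)) p.1) :=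
    (h.differentiable one_ne_zero p).hasFDerivAt
  have h2 : HasFDerivAt (fun x : Space d => φ (x, p.2)) _ p.1 :=
    HasFDerivAt.comp p.1 h1 (hasFDerivAt_prodMk_left p.1 p.2)
  unfold spaceGrad gradient
  exact congrArg _ h2.fderiv

theorem continuous_spaceGrad {d : ℕ} {φ : SpaceTime d → ℝ} (h : ContDiff ℝ 1 φ) :
    Continuous (spaceGrad φ) := by
  rw [funext (spaceGrad_eq h)]
  have := h.continuous_fderiv one_ne_zero
  exact (LinearIsometryEquiv.continuous _).comp (this.clm_comp continuous_const)

theorem hasCompactSupport_spaceGrad {d : ℕ} {φ : SpaceTime d → ℝ} (h : ContDiff ℝ 1 φ)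
    (hc : HasCompactSupport φ) : HasCompactSupport (spaceGrad φ) := by
  refine (hc.fderiv ℝ).mono fun p hp => ?_
  rw [Function.mem_support] at hp ⊢
  contrapose! hp
  rw [spaceGrad_eq h, hp]
  simp

namespace MovingDomain

variable {d : ℕ} (D : MovingDomain d)

/-- The space-time cylinder `Q_T = Ω × (0,T)`. -/
def Q : TopologicalSpace.Opens (SpaceTime d) :=
  ⟨(D.Ω : Set (Space d)) ×ˢ Ioo 0 D.T, D.Ω.isOpen.prod isOpen_Ioo⟩

/-- The observation cylinder `ω_T = ω × (0,T)`. -/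
def ωT : Set (SpaceTime d) := D.ω ×ˢ Ioo 0 D.T

theorem ωT_subset : D.ωT ⊆ (D.Q : Set (SpaceTime d)) := by
  rintro p ⟨hp1, hp2⟩
  have ht : p.2 ∈ Icc 0 D.T := Ioo_subset_Icc_self hp2
  refine ⟨?_, hp2⟩
  rw [D.split p.2 ht]
  exact Or.inl (Or.inr (D.ω_subset p.2 ht hp1))

open Classical in
/-- The diffusion coefficient: `κ₁` in `Q₁` and `κ₂` in `Q₂` (the value on the interface, a null
set, is irrelevant). -/
def diffusion (κ₁ κ₂ : ℝ) (p : SpaceTime d) : ℝ := if p ∈ tube D.Ω₁ D.T then κ₁ else κ₂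

/-- The pairs `(u, G)` in `L²(Q_T) × L²(Q_T; ℝ^d)`, with Hilbert norm `(‖u‖² + ‖G‖²)^{1/2}`. On pairs
`(u, ∇u)` this is the norm of `H^{1,0}(Q_T)`. -/
abbrev Pair : Type :=
  WithLp 2 (L2 (D.Q : Set (SpaceTime d)) × L2Vec (D.Q : Set (SpaceTime d)))

theorem memLp_test (φ : 𝓓^{1}(D.Q, ℝ)) :
    MemLp (φ : SpaceTime d → ℝ) 2 (volume.restrict (D.Q : Set (SpaceTime d))) :=
  (φ.continuous.memLp_of_hasCompactSupport φ.hasCompactSupport).restrict _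

theorem memLp_spaceGrad_test (φ : 𝓓^{1}(D.Q, ℝ)) :
    MemLp (spaceGrad (φ : SpaceTime d → ℝ)) 2 (volume.restrict (D.Q : Set (SpaceTime d))) :=
  ((continuous_spaceGrad φ.contDiff).memLp_of_hasCompactSupport
    (hasCompactSupport_spaceGrad φ.contDiff φ.hasCompactSupport)).restrict _

/-- The pair `(φ, ∇φ)` for `φ ∈ C¹₀(Q_T)`. -/
def testPair (φ : 𝓓^{1}(D.Q, ℝ)) : D.Pair :=
  WithLp.toLp 2 ((D.memLp_test φ).toLp _, (D.memLp_spaceGrad_test φ).toLp _)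

/-- The space `Y = H^{1,0}_0(Q_T)`: the closure of `C¹₀(Q_T)` in the norm of `H^{1,0}(Q_T)`. An
element is a function together with its spatial gradient. -/
def Y : Submodule ℝ D.Pair := (Submodule.span ℝ (range D.testPair)).topologicalClosure

/-- The function underlying an element of `Y`. -/
def toFn (u : D.Y) : L2 (D.Q : Set (SpaceTime d)) := (u : D.Pair).fst

/-- The spatial gradient of an element of `Y`. -/
def grad (u : D.Y) : L2Vec (D.Q : Set (SpaceTime d)) := (u : D.Pair).snd

/-- The inclusion `C¹₀(Q_T) → Y`. -/
def testY (φ : 𝓓^{1}(D.Q, ℝ)) : D.Y :=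
  ⟨D.testPair φ, Submodule.le_topologicalClosure _ (Submodule.subset_span ⟨φ, rfl⟩)⟩

/-- `ξ ∈ Y'` is the distributional time derivative of `u`. -/
def HasTimeDeriv (u : D.Y) (ξ : StrongDual ℝ D.Y) : Prop :=
  ∀ φ : 𝓓^{1}(D.Q, ℝ), ξ (D.testY φ) =
    -∫ p in (D.Q : Set (SpaceTime d)), D.toFn u p * timeDiff (φ : SpaceTime d → ℝ) p

theorem HasTimeDeriv.unique {u : D.Y} {ξ η : StrongDual ℝ D.Y} (hξ : D.HasTimeDeriv u ξ)
    (hη : D.HasTimeDeriv u η) : ξ = η := by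
  have hle : Submodule.span ℝ (range D.testPair) ≤ D.Y := Submodule.le_topologicalClosure _
  have key : ∀ x (hx : x ∈ Submodule.span ℝ (range D.testPair)), ξ ⟨x, hle hx⟩ = η ⟨x, hle hx⟩ := by
    intro x hx
    induction hx using Submodule.span_induction with
    | mem x h =>
      obtain ⟨φ, rfl⟩ := h
      exact (hξ φ).trans (hη φ).symm
    | zero => exact (map_zero ξ).trans (map_zero η).symm
    | add x y hx hy h1 h2 =>
      have e : (⟨x + y, hle (Submodule.add_mem _ hx hy)⟩ : D.Y) = ⟨x, hle hx⟩ + ⟨y, hle hy⟩ := rfl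
      rw [e, map_add, map_add, h1, h2]
    | smul c x hx h1 =>
      have e : (⟨c • x, hle (Submodule.smul_mem _ c hx)⟩ : D.Y) = c • ⟨x, hle hx⟩ := rfl
      rw [e, map_smul, map_smul, h1]
  have hdense : Dense {y : D.Y | (y : D.Pair) ∈ Submodule.span ℝ (range D.testPair)} := by
    intro y
    rw [closure_subtype]
    have hy : (y : D.Pair) ∈ closure (Submodule.span ℝ (range D.testPair) : Set D.Pair) := y.2
    refine closure_mono (fun x hx => ?_) hy
    exact ⟨⟨x, hle hx⟩, hx, rfl⟩
  exact DFunLike.coe_injective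
    (Continuous.ext_on hdense ξ.continuous η.continuous fun y hy => key y hy)

/-- The space `X` of all `u ∈ Y` with `∂ₜu ∈ Y'`. -/
def X : Type := {u : D.Y // ∃ ξ : StrongDual ℝ D.Y, D.HasTimeDeriv u ξ}

/-- The time derivative `∂ₜu ∈ Y'` of `u ∈ X`. -/
def dt (u : D.X) : StrongDual ℝ D.Y := u.2.choose

theorem hasTimeDeriv_dt (u : D.X) : D.HasTimeDeriv u.1 (D.dt u) := u.2.choose_spec

/-- `u(·,0) = 0`: the function `t ↦ u(·,t)` agrees for almost every `t` with a continuous function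
from `[0,T]` to `L²(Ω)` that vanishes at `0`. -/
def VanishesAtZero (u : D.X) : Prop :=
  ∃ w : ℝ → Lp ℝ 2 ((volume : Measure (Space d)).restrict (D.Ω : Set (Space d))),
    ContinuousOn w (Icc 0 D.T) ∧
    (∀ᵐ t ∂(volume : Measure ℝ).restrict (Ioo 0 D.T),
      (fun x => D.toFn u.1 (x, t)) =ᵐ[volume.restrict (D.Ω : Set (Space d))] w t) ∧
    w 0 = 0

/-- The space `X₀` of all `u ∈ X` with `u(·,0) = 0`. -/
def X₀ : Set D.X := {u | D.VanishesAtZero u}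

/-- The bilinear form
`a(u,φ) = ⟨∂ₜu, φ⟩ + ∫_{Q_T} (v · ∇u) φ + κ ∇u · ∇φ` on `X × Y`. -/
def form (κ₁ κ₂ : ℝ) (u : D.X) (φ : D.Y) : ℝ :=
  D.dt u φ + ∫ p in (D.Q : Set (SpaceTime d)),
    (inner ℝ (D.v p.2 p.1) (D.grad u.1 p) * D.toFn φ p +
      D.diffusion κ₁ κ₂ p * inner ℝ (D.grad u.1 p) (D.grad φ p))

/-- `u ∈ X₀` is the weak solution with source `F`: `a(u,φ) = (F,φ)` for all `φ ∈ Y`. -/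
def IsWeakSolution (κ₁ κ₂ : ℝ) (F : L2 (D.Q : Set (SpaceTime d))) (u : D.X) : Prop :=
  u ∈ D.X₀ ∧ ∀ φ : D.Y, D.form κ₁ κ₂ u φ = inner ℝ F (D.toFn φ)

/-- The admissible set `F₊` of all `f ∈ L²(Q_T)` with `f ≥ 0` almost everywhere. -/
def admissible : Set (L2 (D.Q : Set (SpaceTime d))) :=
  {f | ∀ᵐ p ∂(volume : Measure (SpaceTime d)).restrict (D.Q : Set (SpaceTime d)), 0 ≤ f p}

/-- The restriction of `u` to `ω_T`, in `L²(ω_T)`. -/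
def observe (u : D.X) : L2 D.ωT := restrictL2 D.ωT_subset (D.toFn u.1)

/-- The Tikhonov functional `½ ‖u(f) - z‖²_{L²(ω_T)} + (lam/2) ‖f‖²_{L²(Q_T)}`, where `S` is the map
from a source `F` to the weak solution, and `u(f) = S (ℓ f)`. -/
def tikhonov (S : L2 (D.Q : Set (SpaceTime d)) → D.X)
    (ℓ : Lp ℝ ∞ ((volume : Measure (SpaceTime d)).restrict (D.Q : Set (SpaceTime d))))
    (z : L2 D.ωT) (lam : ℝ) (f : L2 (D.Q : Set (SpaceTime d))) : ℝ :=
  1 / 2 * ‖D.observe (S (ℓ • f)) - z‖ ^ 2 + lam / 2 * ‖f‖ ^ 2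

end MovingDomain

end AdvDiff

end

noncomputable section

namespace AdvDiff

/-! ### Square-integrable functions -/

/-! The parabolic problem is reduced to one variational identity. An element `u` of `Y` is a weak
solution with zero initial value exactly when `-(u, ∂ₜφ) + B(u, φ) = (F, φ)` for all `C¹` test
functions `φ` on `Ω × ℝ` that vanish near and after time `T` but are unrestricted at time `0`. Here
`B` is the spatial part `spaceForm` of the form, and the identity is `Solves`, an instance of
`HasTimeDerivFromZero`. The freedom at time `0` encodes the initial condition.

`B` is coercive on `Y`: the transport term vanishes on the diagonal since `v` is divergence free,
the diffusion term dominates `‖∇u‖²`, and Poincaré's inequality controls `‖u‖` (`exists_coercive`).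

Existence is Lions' projection theorem (`exists_inner_eq_of_bound`): for such test functions `-(φ,
∂ₜφ) = ½‖φ(0)‖² ≥ 0`, so the adjoint operator is bounded below.

Uniqueness needs `⟨∂ₜu, u⟩ ≥ 0`. It comes from approximating `u` in `Y`, and at the same time `∂ₜu`
in `Y'`, by test functions that vanish for `t ≤ 0` (`HasTimeDerivFromZero.exists_test`). These are
Steklov averages over `[t - h, t]`; averages leave the time interval, which is why test functions
live on `Ω × ℝ`. The same approximants are uniformly Cauchy in `L²(Ω)`, which produces the
continuous representative vanishing at `0` (`HasTimeDerivFromZero.exists_continuousOn`). The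
converse, `hasTimeDerivFromZero_of_continuousOn`, multiplies test functions by a steep ramp at time
`0` and lets the ramp tend to `1`.

The solution operator is therefore linear and bounded, and so is the map from `f` to the observed
`u(f)`. The Tikhonov functional becomes half a squared distance to the image of a closed convex set
under an operator bounded below, and the nearest point is unique (`existsUnique_isMinOn_tikhonov`).
-/

theorem inner_toLp {α E : Type*} [MeasurableSpace α] {μ : Measure α} [NormedAddCommGroup E]
    [InnerProductSpace ℝ E] {f g : α → E} (hf : MemLp f 2 μ) (hg : MemLp g 2 μ) :
    inner ℝ (hf.toLp f) (hg.toLp g) = ∫ x, inner ℝ (f x) (g x) ∂μ := by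
  rw [L2.inner_def]
  refine integral_congr_ae ?_
  filter_upwards [hf.coeFn_toLp, hg.coeFn_toLp] with x h1 h2
  rw [h1, h2]

theorem norm_toLp_sq {α E : Type*} [MeasurableSpace α] {μ : Measure α} [NormedAddCommGroup E]
    [InnerProductSpace ℝ E] {f : α → E} (hf : MemLp f 2 μ) :
    ‖hf.toLp f‖ ^ 2 = ∫ x, ‖f x‖ ^ 2 ∂μ := by
  rw [← real_inner_self_eq_norm_sq, inner_toLp]
  simp only [real_inner_self_eq_norm_sq]

theorem inner_toLp_right {α E : Type*} [MeasurableSpace α] {μ : Measure α} [NormedAddCommGroup E]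
    [InnerProductSpace ℝ E] {g : α → E} (u : Lp E 2 μ) (hg : MemLp g 2 μ) :
    inner ℝ u (hg.toLp g) = ∫ x, inner ℝ (u x) (g x) ∂μ := by
  rw [L2.inner_def]
  refine integral_congr_ae ?_
  filter_upwards [hg.coeFn_toLp] with x h2
  rw [h2]

/-- Dominated convergence: on a finite measure the constant `C ^ 2` is an integrable majorant of the
squared difference. -/
theorem tendsto_toLp_of_bounded {α E : Type*} [MeasurableSpace α] {μ : Measure α}
    [IsFiniteMeasure μ] [NormedAddCommGroup E] [InnerProductSpace ℝ E] {f : ℕ → α → E} {g : α → E}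
    (hf : ∀ n, MemLp (f n) 2 μ) (hg : MemLp g 2 μ) (C : ℝ)
    (hC : ∀ n, ∀ᵐ x ∂μ, ‖f n x - g x‖ ≤ C)
    (hlim : ∀ᵐ x ∂μ, Tendsto (fun n => f n x) atTop (𝓝 (g x))) :
    Tendsto (fun n => (hf n).toLp (f n)) atTop (𝓝 (hg.toLp g)) := by
  rw [tendsto_iff_norm_sub_tendsto_zero]
  have h2 : ∀ n, ‖(hf n).toLp (f n) - hg.toLp g‖ ^ 2 = ∫ x, ‖f n x - g x‖ ^ 2 ∂μ := fun n => by
    rw [← MemLp.toLp_sub, norm_toLp_sq]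
    rfl
  have h3 : Tendsto (fun n => ∫ x, ‖f n x - g x‖ ^ 2 ∂μ) atTop (𝓝 (∫ _, (0 : ℝ) ∂μ)) := by
    refine tendsto_integral_of_dominated_convergence (fun _ => C ^ 2) (fun n => ?_)
      (integrable_const _) (fun n => ?_) ?_
    · exact ((hf n).1.sub hg.1).norm.pow 2
    · filter_upwards [hC n] with x hx
      rw [norm_pow, norm_norm]
      gcongr
    · filter_upwards [hlim] with x hx
      have := ((tendsto_iff_norm_sub_tendsto_zero.1 hx).pow 2)
      simpa using this
  rw [integral_zero] at h3
  have h4 : Tendsto (fun n => ‖(hf n).toLp (f n) - hg.toLp g‖ ^ 2) atTop (𝓝 0) := by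
    simpa only [h2] using h3
  have h5 := h4.sqrt
  simpa using h5

/-! ### Derivatives of functions on space-time -/

section Calculus

variable {d : ℕ} {φ ψ : SpaceTime d → ℝ}

theorem hasDerivAt_time (h : ContDiff ℝ 1 φ) (p : SpaceTime d) :
    HasDerivAt (fun s => φ (p.1, s)) (fderiv ℝ φ p (0, 1)) p.2 := by
  have h1 : HasFDerivAt φ (fderiv ℝ φ p) (p.1, p.2) :=
    (h.differentiable one_ne_zero p).hasFDerivAt
  have h2 : HasDerivAt (fun s : ℝ => (p.1, s)) ((0 : Space d), (1 : ℝ)) p.2 :=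
    (hasDerivAt_const _ _).prodMk (hasDerivAt_id _)
  exact h1.comp_hasDerivAt p.2 h2

theorem timeDiff_eq (h : ContDiff ℝ 1 φ) (p : SpaceTime d) :
    timeDiff φ p = fderiv ℝ φ p (0, 1) :=
  (hasDerivAt_time h p).deriv

theorem hasDerivAt_timeDiff (h : ContDiff ℝ 1 φ) (x : Space d) (t : ℝ) :
    HasDerivAt (fun s => φ (x, s)) (timeDiff φ (x, t)) t := by
  rw [timeDiff_eq h]
  exact hasDerivAt_time h (x, t)

theorem continuous_timeDiff (h : ContDiff ℝ 1 φ) : Continuous (timeDiff φ) := by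
  rw [funext (timeDiff_eq h)]
  exact (h.continuous_fderiv one_ne_zero).clm_apply continuous_const

theorem hasCompactSupport_timeDiff (h : ContDiff ℝ 1 φ) (hc : HasCompactSupport φ) :
    HasCompactSupport (timeDiff φ) := by
  refine (hc.fderiv ℝ).mono fun p hp => ?_
  rw [Function.mem_support] at hp ⊢
  contrapose! hp
  rw [timeDiff_eq h, hp]
  simp

theorem fderiv_eq_zero_of_notMem_tsupport {p : SpaceTime d} (hp : p ∉ tsupport φ) :
    fderiv ℝ φ p = 0 := by
  by_contra h
  exact hp (support_fderiv_subset ℝ (f := φ) h)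

theorem spaceGrad_eq_zero_of_notMem_tsupport (h : ContDiff ℝ 1 φ) {p : SpaceTime d}
    (hp : p ∉ tsupport φ) : spaceGrad φ p = 0 := by
  rw [spaceGrad_eq h, fderiv_eq_zero_of_notMem_tsupport hp]
  simp

theorem spaceGrad_add (hφ : ContDiff ℝ 1 φ) (hψ : ContDiff ℝ 1 ψ) :
    spaceGrad (φ + ψ) = spaceGrad φ + spaceGrad ψ := by
  funext p
  have h : ContDiff ℝ 1 (φ + ψ) := hφ.add hψ
  rw [Pi.add_apply, spaceGrad_eq hφ, spaceGrad_eq hψ, spaceGrad_eq h,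
    fderiv_add (hφ.differentiable one_ne_zero p) (hψ.differentiable one_ne_zero p),
    ContinuousLinearMap.add_comp, map_add]

theorem spaceGrad_smul (hφ : ContDiff ℝ 1 φ) (c : ℝ) :
    spaceGrad (c • φ) = c • spaceGrad φ := by
  funext p
  have h : ContDiff ℝ 1 (c • φ) := contDiff_const.smul hφ
  rw [Pi.smul_apply, spaceGrad_eq hφ, spaceGrad_eq h,
    fderiv_const_smul (hφ.differentiable one_ne_zero p), ContinuousLinearMap.smul_comp]
  simp

theorem timeDiff_add (hφ : ContDiff ℝ 1 φ) (hψ : ContDiff ℝ 1 ψ) :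
    timeDiff (φ + ψ) = timeDiff φ + timeDiff ψ := by
  funext p
  exact ((hasDerivAt_timeDiff hφ p.1 p.2).add (hasDerivAt_timeDiff hψ p.1 p.2)).deriv

theorem timeDiff_smul (hφ : ContDiff ℝ 1 φ) (c : ℝ) :
    timeDiff (c • φ) = c • timeDiff φ := by
  funext p
  exact ((hasDerivAt_timeDiff hφ p.1 p.2).const_smul c).deriv

/-- For the spatial gradient the factor `χ p.2` is a constant, so `χ` needs no regularity. -/
theorem spaceGrad_mul_time (hφ : ContDiff ℝ 1 φ) (χ : ℝ → ℝ) (p : SpaceTime d) :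
    spaceGrad (fun q => χ q.2 * φ q) p = χ p.2 • spaceGrad φ p := by
  have h1 : DifferentiableAt ℝ (fun x : Space d => φ (x, p.2)) p.1 :=
    (hφ.comp (contDiff_prodMk_left p.2)).differentiable one_ne_zero p.1
  have h2 := h1.hasFDerivAt.const_smul (χ p.2)
  unfold spaceGrad gradient
  rw [show (fun x : Space d => χ (x, p.2).2 * φ (x, p.2)) = χ p.2 • fun x => φ (x, p.2) from rfl,
    h2.fderiv]
  simp

theorem timeDiff_mul_time (hφ : ContDiff ℝ 1 φ) {χ : ℝ → ℝ} (hχ : ContDiff ℝ 1 χ)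
    (p : SpaceTime d) :
    timeDiff (fun q => χ q.2 * φ q) p = deriv χ p.2 * φ p + χ p.2 * timeDiff φ p :=
  ((hχ.differentiable one_ne_zero p.2).hasDerivAt.mul (hasDerivAt_timeDiff hφ p.1 p.2)).deriv

end Calculus

/-! ### Smooth cutoff functions in time -/

/-- A smooth function with values in `[0,1]`, supported in `[a + 1/n, b - 1/n]`. -/
def cutoff (a b : ℝ) (n : ℕ) (t : ℝ) : ℝ :=
  Real.smoothTransition (n * (t - a) - 1) * Real.smoothTransition (n * (b - t) - 1)

theorem contDiff_cutoff (a b : ℝ) (n : ℕ) : ContDiff ℝ 1 (cutoff a b n) := by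
  unfold cutoff
  have := Real.smoothTransition.contDiff (n := 1)
  exact (this.comp (by fun_prop)).mul (this.comp (by fun_prop))

theorem cutoff_nonneg (a b : ℝ) (n : ℕ) (t : ℝ) : 0 ≤ cutoff a b n t :=
  mul_nonneg (Real.smoothTransition.nonneg _) (Real.smoothTransition.nonneg _)

theorem cutoff_le_one (a b : ℝ) (n : ℕ) (t : ℝ) : cutoff a b n t ≤ 1 :=
  mul_le_one₀ (Real.smoothTransition.le_one _) (Real.smoothTransition.nonneg _)
    (Real.smoothTransition.le_one _)

theorem abs_cutoff_le (a b : ℝ) (n : ℕ) (t : ℝ) : |cutoff a b n t| ≤ 1 := by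
  rw [abs_of_nonneg (cutoff_nonneg a b n t)]
  exact cutoff_le_one a b n t

theorem tsupport_cutoff_subset (a b : ℝ) (n : ℕ) : tsupport (cutoff a b n) ⊆ Ioo a b := by
  -- For `n = 0` both transition arguments equal `-1`, so the cutoff is identically zero; the bounds
  -- with `1 / n` need `n > 0`.
  rcases Nat.eq_zero_or_pos n with rfl | hn
  · have : cutoff a b 0 = 0 := by
      funext t
      simp [cutoff, Real.smoothTransition.zero_of_nonpos]
    rw [this, tsupport_zero]
    exact empty_subset _
  · have hn' : (0 : ℝ) < n := by exact_mod_cast hn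
    have h1 : tsupport (cutoff a b n) ⊆ Icc (a + 1 / n) (b - 1 / n) := by
      refine closure_minimal (fun t ht => ?_) isClosed_Icc
      by_contra hc
      apply ht
      rw [mem_Icc, not_and_or, not_le, not_le] at hc
      rcases hc with hc | hc
      · have : n * (t - a) - 1 ≤ 0 := by
          have : n * (t - a) ≤ n * (1 / n) := by gcongr; linarith
          rw [mul_one_div_cancel hn'.ne'] at this
          linarith
        simp [cutoff, Real.smoothTransition.zero_of_nonpos this]
      · have : n * (b - t) - 1 ≤ 0 := by
          have : n * (b - t) ≤ n * (1 / n) := by gcongr; linarith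
          rw [mul_one_div_cancel hn'.ne'] at this
          linarith
        simp [cutoff, Real.smoothTransition.zero_of_nonpos this]
    have : (0 : ℝ) < 1 / n := by positivity
    exact h1.trans fun t ht => ⟨by linarith [ht.1], by linarith [ht.2]⟩

theorem tendsto_cutoff {a b t : ℝ} (ht : t ∈ Ioo a b) :
    Tendsto (fun n => cutoff a b n t) atTop (𝓝 1) := by
  have h : ∀ {r : ℝ}, 0 < r → ∀ᶠ n : ℕ in atTop, Real.smoothTransition (n * r - 1) = 1 := by
    intro r hr
    -- From `n ≥ 2 / r` on, the argument `n * r - 1` is at least `1`, where the transition function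
    -- has reached `1`.
    obtain ⟨N, hN⟩ := exists_nat_ge (2 / r)
    filter_upwards [eventually_ge_atTop N] with n hn
    apply Real.smoothTransition.one_of_one_le
    have : 2 / r ≤ n := hN.trans (by exact_mod_cast hn)
    rw [div_le_iff₀ hr] at this
    linarith
  refine tendsto_const_nhds.congr' ?_
  filter_upwards [h (sub_pos.2 ht.1), h (sub_pos.2 ht.2)] with n h1 h2
  simp [cutoff, h1, h2]

theorem cutoff_eq_zero {a b t : ℝ} (ht : t ∉ Ioo a b) (n : ℕ) : cutoff a b n t = 0 := by
  by_contra h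
  exact ht (tsupport_cutoff_subset a b n (subset_tsupport _ h))

/-! ### Test functions on the infinite cylinder -/

namespace MovingDomain

variable {d : ℕ} (D : MovingDomain d)

/-- The infinite cylinder `Ω × ℝ`. -/
def cylinder : TopologicalSpace.Opens (SpaceTime d) :=
  ⟨(D.Ω : Set (Space d)) ×ˢ univ, D.Ω.isOpen.prod isOpen_univ⟩

/-- Test functions of class `C¹` with compact support in `Ω × ℝ`. -/
abbrev Test : Type := 𝓓^{1}(D.cylinder, ℝ)

variable {D}

/-- A compactly supported `C¹` function on space-time, supported in `Ω × ℝ`, as a test function. -/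
abbrev mkTest (φ : SpaceTime d → ℝ) (h : ContDiff ℝ 1 φ) (hc : HasCompactSupport φ)
    (hs : ∀ p ∈ tsupport φ, p.1 ∈ D.Ω) : D.Test :=
  ⟨φ, h, hc, fun p hp => ⟨hs p hp, trivial⟩⟩

/-- A test function supported in a smaller open set is a test function. -/
def extend {U : TopologicalSpace.Opens (SpaceTime d)} (hU : ∀ p ∈ U, p.1 ∈ D.Ω) :
    𝓓^{1}(U, ℝ) →ₗ[ℝ] D.Test where
  toFun φ := mkTest φ φ.contDiff φ.hasCompactSupport fun p hp => hU p (φ.tsupport_subset hp)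
  map_add' _ _ := rfl
  map_smul' _ _ := rfl

theorem contDiff_test (φ : D.Test) : ContDiff ℝ 1 (φ : SpaceTime d → ℝ) := φ.contDiff

theorem fst_mem_of_mem_tsupport (φ : D.Test) {p : SpaceTime d}
    (hp : p ∈ tsupport (φ : SpaceTime d → ℝ)) : p.1 ∈ D.Ω :=
  (φ.tsupport_subset hp).1

variable (D) in
theorem isFiniteMeasure_Q :
    IsFiniteMeasure ((volume : Measure (SpaceTime d)).restrict (D.Q : Set (SpaceTime d))) := by
  rw [isFiniteMeasure_restrict]
  exact ((D.bounded.prod (Metric.isBounded_Ioo 0 D.T)).measure_lt_top).ne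

theorem memLp_of_hasCompactSupport {E : Type*} [NormedAddCommGroup E] {f : SpaceTime d → E}
    (hf : Continuous f) (hc : HasCompactSupport f) :
    MemLp f 2 (volume.restrict (D.Q : Set (SpaceTime d))) :=
  (hf.memLp_of_hasCompactSupport hc).restrict _

theorem memLp_fn (φ : D.Test) :
    MemLp (φ : SpaceTime d → ℝ) 2 (volume.restrict (D.Q : Set (SpaceTime d))) :=
  memLp_of_hasCompactSupport φ.continuous φ.hasCompactSupport

theorem memLp_spaceGrad (φ : D.Test) :
    MemLp (spaceGrad (φ : SpaceTime d → ℝ)) 2 (volume.restrict (D.Q : Set (SpaceTime d))) :=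
  memLp_of_hasCompactSupport (continuous_spaceGrad φ.contDiff)
    (hasCompactSupport_spaceGrad φ.contDiff φ.hasCompactSupport)

theorem memLp_timeDiff (φ : D.Test) :
    MemLp (timeDiff (φ : SpaceTime d → ℝ)) 2 (volume.restrict (D.Q : Set (SpaceTime d))) :=
  memLp_of_hasCompactSupport (continuous_timeDiff φ.contDiff)
    (hasCompactSupport_timeDiff φ.contDiff φ.hasCompactSupport)

/-- The class in `L²(Q_T)` of a test function. -/
def fnL2 : D.Test →ₗ[ℝ] L2 (D.Q : Set (SpaceTime d)) where
  toFun φ := (memLp_fn φ).toLp _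
  map_add' _ _ := MemLp.toLp_add _ _
  map_smul' _ _ := MemLp.toLp_const_smul _ _

/-- The class in `L²(Q_T; ℝ^d)` of the spatial gradient of a test function. -/
def gradL2 : D.Test →ₗ[ℝ] L2Vec (D.Q : Set (SpaceTime d)) where
  toFun φ := (memLp_spaceGrad φ).toLp _
  map_add' φ ψ := by
    rw [← MemLp.toLp_add]
    exact MemLp.toLp_congr _ _ (.of_eq (spaceGrad_add (contDiff_test φ) (contDiff_test ψ)))
  map_smul' c φ := by
    rw [RingHom.id_apply, ← MemLp.toLp_const_smul]
    exact MemLp.toLp_congr _ _ (.of_eq (spaceGrad_smul (contDiff_test φ) c))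

/-- The class in `L²(Q_T)` of the time derivative of a test function. -/
def dtL2 : D.Test →ₗ[ℝ] L2 (D.Q : Set (SpaceTime d)) where
  toFun φ := (memLp_timeDiff φ).toLp _
  map_add' φ ψ := by
    rw [← MemLp.toLp_add]
    exact MemLp.toLp_congr _ _ (.of_eq (timeDiff_add (contDiff_test φ) (contDiff_test ψ)))
  map_smul' c φ := by
    rw [RingHom.id_apply, ← MemLp.toLp_const_smul]
    exact MemLp.toLp_congr _ _ (.of_eq (timeDiff_smul (contDiff_test φ) c))

instance completeSpace_Y : CompleteSpace D.Y :=
  (Submodule.isClosed_topologicalClosure _).completeSpace_coe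

/-- The product of a test function with a function of time. -/
def mulTime (χ : ℝ → ℝ) (hχ : ContDiff ℝ 1 χ) (φ : D.Test) : D.Test :=
  mkTest (fun p => χ p.2 * φ p) ((hχ.comp contDiff_snd).mul (contDiff_test φ))
    (HasCompactSupport.mul_left φ.hasCompactSupport)
    fun _ hp => fst_mem_of_mem_tsupport φ (tsupport_mul_subset_right hp)

theorem tsupport_mulTime_subset (χ : ℝ → ℝ) (hχ : ContDiff ℝ 1 χ) (φ : D.Test) :
    tsupport (mulTime χ hχ φ : SpaceTime d → ℝ) ⊆ tsupport φ ∩ Prod.snd ⁻¹' tsupport χ := by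
  refine fun p hp => ⟨tsupport_mul_subset_right hp, ?_⟩
  have : tsupport (fun q : SpaceTime d => χ q.2) ⊆ Prod.snd ⁻¹' tsupport χ :=
    tsupport_comp_subset_preimage χ continuous_snd
  exact this (tsupport_mul_subset_left hp)

/-- A test function supported in `Q_T`. -/
def toQ (φ : D.Test) (h : ∀ p ∈ tsupport (φ : SpaceTime d → ℝ), p.2 ∈ Ioo 0 D.T) :
    𝓓^{1}(D.Q, ℝ) :=
  ⟨φ, φ.contDiff, φ.hasCompactSupport, fun p hp => ⟨fst_mem_of_mem_tsupport φ hp, h p hp⟩⟩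

theorem fst_mem_of_mem_Q {p : SpaceTime d} (hp : p ∈ D.Q) : p.1 ∈ D.Ω := hp.1

/-- The inclusion of `C¹₀(Q_T)` into the test functions on `Ω × ℝ`. -/
abbrev ofQ : 𝓓^{1}(D.Q, ℝ) →ₗ[ℝ] D.Test := extend fun _ => fst_mem_of_mem_Q

/-- The pair `(φ, ∇φ)` for a test function on `Ω × ℝ`. -/
def pairOf (φ : D.Test) : D.Pair := WithLp.toLp 2 (fnL2 φ, gradL2 φ)

theorem exists_norm_le {E : Type*} [NormedAddCommGroup E] {f : SpaceTime d → E}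
    (hf : Continuous f) (hc : HasCompactSupport f) : ∃ C, 0 ≤ C ∧ ∀ p, ‖f p‖ ≤ C := by
  obtain ⟨C, hC⟩ := hf.bounded_above_of_compact_support hc
  exact ⟨C, (norm_nonneg _).trans (hC 0), hC⟩

section MulTime

variable {χ : ℕ → ℝ → ℝ} (hχ : ∀ n, ContDiff ℝ 1 (χ n))

/-- Vector-valued, with an arbitrary profile `χ`, so that it serves a test function, its spatial
gradient and its time derivative, both for `cutoff` and for `ramp`. -/
theorem tendsto_toLp_mulTime {E : Type*} [NormedAddCommGroup E] [InnerProductSpace ℝ E]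
    {f : SpaceTime d → E} {g : ℕ → SpaceTime d → E} (hf : Continuous f) (hc : HasCompactSupport f)
    (hg : ∀ n p, g n p = χ n p.2 • f p)
    (hgm : ∀ n, MemLp (g n) 2 (volume.restrict (D.Q : Set (SpaceTime d))))
    (hfm : MemLp f 2 (volume.restrict (D.Q : Set (SpaceTime d))))
    (hb : ∀ n t, |χ n t| ≤ 1) (hlim : ∀ t ∈ Ioo 0 D.T, Tendsto (fun n => χ n t) atTop (𝓝 1)) :
    Tendsto (fun n => (hgm n).toLp (g n)) atTop (𝓝 (hfm.toLp f)) := by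
  have := D.isFiniteMeasure_Q
  obtain ⟨C, _, hC⟩ := exists_norm_le hf hc
  refine tendsto_toLp_of_bounded hgm hfm (C + C) (fun n => Eventually.of_forall fun p => ?_) ?_
  · refine (norm_sub_le _ _).trans (add_le_add ?_ (hC p))
    rw [hg, norm_smul]
    exact (mul_le_of_le_one_left (norm_nonneg _) (hb _ _)).trans (hC p)
  · filter_upwards [self_mem_ae_restrict D.Q.isOpen.measurableSet] with p hp
    have := (hlim _ hp.2).smul_const (f p)
    simpa only [hg, one_smul] using this

theorem tendsto_pairOf_mulTime (φ : D.Test) (hb : ∀ n t, |χ n t| ≤ 1)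
    (hlim : ∀ t ∈ Ioo 0 D.T, Tendsto (fun n => χ n t) atTop (𝓝 1)) :
    Tendsto (fun n => pairOf (mulTime (χ n) (hχ n) φ)) atTop (𝓝 (pairOf φ)) := by
  have e1 : Tendsto (fun n => fnL2 (mulTime (χ n) (hχ n) φ)) atTop (𝓝 (fnL2 φ)) :=
    tendsto_toLp_mulTime (f := φ) (g := fun n => mulTime (χ n) (hχ n) φ) φ.continuous φ.hasCompactSupport (fun n p => rfl)
      (fun n => memLp_fn (mulTime (χ n) (hχ n) φ))
      (memLp_fn φ) hb hlim
  have e2 : Tendsto (fun n => gradL2 (mulTime (χ n) (hχ n) φ)) atTop (𝓝 (gradL2 φ)) :=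
    tendsto_toLp_mulTime (f := spaceGrad φ) (g := fun n => spaceGrad (mulTime (χ n) (hχ n) φ))
      (continuous_spaceGrad (contDiff_test φ))
      (hasCompactSupport_spaceGrad (contDiff_test φ) φ.hasCompactSupport)
      (fun n => spaceGrad_mul_time (contDiff_test φ) (χ n))
      (fun n => memLp_spaceGrad (mulTime (χ n) (hχ n) φ))
      (memLp_spaceGrad φ) hb hlim
  exact ((WithLp.prod_continuous_toLp 2 _ _).tendsto _).comp (e1.prodMk_nhds e2)

end MulTime

/-- The norm of `Y` contains no time derivative, so cutting off in time near `0` and `T` costs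
nothing in the limit, however steep the cutoff. Hence membership in `Y` imposes no condition at the
ends of the time interval. -/
theorem pairOf_mem (φ : D.Test) : pairOf φ ∈ D.Y := by
  refine (Submodule.isClosed_topologicalClosure _).mem_of_tendsto
    (tendsto_pairOf_mulTime (fun n => contDiff_cutoff 0 D.T n) φ (abs_cutoff_le 0 D.T)
      fun _ => tendsto_cutoff)
    (Eventually.of_forall fun n => ?_)
  exact (D.testY (toQ (mulTime (cutoff 0 D.T n) (contDiff_cutoff _ _ n) φ) fun p hp =>
    tsupport_cutoff_subset _ _ n (tsupport_mulTime_subset _ _ φ hp).2)).2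

/-- The element of `Y` given by a test function on `Ω × ℝ`. -/
def toY : D.Test →ₗ[ℝ] D.Y where
  toFun φ := ⟨pairOf φ, pairOf_mem φ⟩
  map_add' φ ψ := by
    ext1
    change pairOf (φ + ψ) = pairOf φ + pairOf ψ
    simp only [pairOf, map_add, ← WithLp.toLp_add, Prod.mk_add_mk]
  map_smul' c φ := by
    ext1
    change pairOf (c • φ) = c • pairOf φ
    simp only [pairOf, map_smul, ← WithLp.toLp_smul, Prod.smul_mk]

theorem toFn_toY (φ : D.Test) : D.toFn (toY φ) = fnL2 φ := rfl

theorem grad_toY (φ : D.Test) : D.grad (toY φ) = gradL2 φ := rfl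

theorem testY_eq (φ : 𝓓^{1}(D.Q, ℝ)) : D.testY φ = toY (ofQ φ) := rfl

variable (D) in
-- The test functions already form a vector space, so the span in the definition of `Y` is contained
-- in the range of a linear map. This makes `extendOfNorm` and density arguments available.
theorem denseRange_toY_ofQ : DenseRange (toY ∘ₗ ofQ : 𝓓^{1}(D.Q, ℝ) →ₗ[ℝ] D.Y) := by
  intro y
  rw [closure_subtype]
  have hle : Submodule.span ℝ (range D.testPair) ≤
      LinearMap.range (D.Y.subtype ∘ₗ (toY ∘ₗ ofQ : 𝓓^{1}(D.Q, ℝ) →ₗ[ℝ] D.Y)) := by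
    rw [Submodule.span_le]
    rintro _ ⟨φ, rfl⟩
    exact ⟨φ, rfl⟩
  refine closure_mono (fun x hx => ?_) (show (y : D.Pair) ∈ closure _ from y.2)
  obtain ⟨φ, rfl⟩ := hle hx
  exact ⟨_, ⟨φ, rfl⟩, rfl⟩

theorem tendsto_toY_mulTime {χ : ℕ → ℝ → ℝ} (hχ : ∀ n, ContDiff ℝ 1 (χ n)) (φ : D.Test)
    (hb : ∀ n t, |χ n t| ≤ 1) (hlim : ∀ t ∈ Ioo 0 D.T, Tendsto (fun n => χ n t) atTop (𝓝 1)) :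
    Tendsto (fun n => toY (mulTime (χ n) (hχ n) φ)) atTop (𝓝 (toY φ)) :=
  tendsto_subtype_rng.2 (tendsto_pairOf_mulTime hχ φ hb hlim)

end MovingDomain

/-! ### The divergence theorem for compactly supported fields -/

theorem divergence_eq_sum {d : ℕ} {G : Space d → Space d} {x : Space d}
    (hG : DifferentiableAt ℝ G x) :
    divergence G x =
      ∑ i, fderiv ℝ (fun y => G y i) x (EuclideanSpace.basisFun (Fin d) ℝ i) := by
  rw [divergence, LinearMap.trace_eq_sum_inner _ (EuclideanSpace.basisFun (Fin d) ℝ)]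
  refine Finset.sum_congr rfl fun i _ => ?_
  have h : HasFDerivAt (fun y => G y i)
      ((EuclideanSpace.proj i : Space d →L[ℝ] ℝ).comp (fderiv ℝ G x)) x :=
    (EuclideanSpace.proj i : Space d →L[ℝ] ℝ).hasFDerivAt.comp x hG.hasFDerivAt
  rw [h.fderiv]
  simp [EuclideanSpace.inner_single_left]

theorem integral_fderiv_apply_eq_zero {d : ℕ} {f : Space d → ℝ} (hf : ContDiff ℝ 1 f)
    (hc : HasCompactSupport f) (e : Space d) : ∫ x, fderiv ℝ f x e = 0 := by
  have hi : Integrable fun x => fderiv ℝ f x e :=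
    ((hf.continuous_fderiv one_ne_zero).clm_apply continuous_const).integrable_of_hasCompactSupport
      (hc.fderiv_apply ℝ e)
  -- Integration by parts against the constant function `1`.
  have := integral_mul_fderiv_eq_neg_fderiv_mul_of_integrable (𝕜 := ℝ)
    (μ := (volume : Measure (Space d))) (f := fun _ => 1) (g := f) (v := e) (by simp)
    (by simpa using hi) (by simpa using hf.continuous.integrable_of_hasCompactSupport hc)
    (fun x _ => differentiableAt_const _) (fun x _ => hf.differentiable one_ne_zero x)
  simpa using this

theorem integral_divergence_eq_zero {d : ℕ} {G : Space d → Space d} (hG : ContDiff ℝ 1 G)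
    (hc : HasCompactSupport G) : ∫ x, divergence G x = 0 := by
  have hGi : ∀ i, ContDiff ℝ 1 fun x => G x i := fun i =>
    (EuclideanSpace.proj i : Space d →L[ℝ] ℝ).contDiff.comp hG
  have hci : ∀ i, HasCompactSupport fun x => G x i := fun i =>
    hc.comp_left (g := fun y : Space d => y i) rfl
  simp only [divergence_eq_sum (hG.differentiable one_ne_zero _)]
  rw [integral_finsetSum]
  · exact Finset.sum_eq_zero fun i _ => integral_fderiv_apply_eq_zero (hGi i) (hci i) _
  · intro i _
    exact (((hGi i).continuous_fderiv one_ne_zero).clm_apply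
      continuous_const).integrable_of_hasCompactSupport ((hci i).fderiv_apply ℝ _)

theorem divergence_smul {d : ℕ} {f : Space d → ℝ} {w : Space d → Space d} {x : Space d}
    (hf : DifferentiableAt ℝ f x) (hw : DifferentiableAt ℝ w x) :
    divergence (fun y => f y • w y) x = inner ℝ (w x) (gradient f x) + f x * divergence w x := by
  have h := hf.hasFDerivAt.smul hw.hasFDerivAt
  have h1 : (fderiv ℝ (fun y => f y • w y) x : Space d →ₗ[ℝ] Space d) =
      f x • (fderiv ℝ w x : Space d →ₗ[ℝ] Space d) +
        ((fderiv ℝ f x).smulRight (w x) : Space d →L[ℝ] Space d) := by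
    rw [show (fun y => f y • w y) = f • w from rfl, h.fderiv]
    rfl
  have h2 : LinearMap.trace ℝ (Space d)
      (((fderiv ℝ f x).smulRight (w x) : Space d →L[ℝ] Space d) : Space d →ₗ[ℝ] Space d) =
        fderiv ℝ f x (w x) :=
    LinearMap.trace_smulRight (fderiv ℝ f x : Space d →ₗ[ℝ] ℝ) (w x)
  rw [divergence, h1, map_add, map_smul, h2, divergence, smul_eq_mul, add_comm, gradient,
    real_inner_comm, InnerProductSpace.toDual_symm_apply]

/-- The field `w` is regular only in `Ω`, but `f • w` is `C¹` on the whole space because `f`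
vanishes near every point outside `Ω`. The divergence theorem then applies without any regularity of
`∂Ω`. -/
theorem setIntegral_inner_gradient_add {d : ℕ} {Ω : Set (Space d)} (hΩ : IsOpen Ω)
    {f : Space d → ℝ} {w : Space d → Space d} (hf : ContDiff ℝ 1 f) (hc : HasCompactSupport f)
    (hs : tsupport f ⊆ Ω) (hw : ContDiffOn ℝ 1 w Ω) :
    ∫ x in Ω, (inner ℝ (w x) (gradient f x) + f x * divergence w x) = 0 := by
  have hG : ContDiff ℝ 1 fun y => f y • w y := by
    rw [contDiff_iff_contDiffAt]
    intro x
    by_cases hx : x ∈ Ω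
    · exact hf.contDiffAt.smul (hw.contDiffAt (hΩ.mem_nhds hx))
    · have h0 : f =ᶠ[𝓝 x] 0 := notMem_tsupport_iff_eventuallyEq.1 fun h => hx (hs h)
      refine (contDiffAt_const (c := (0 : Space d))).congr_of_eventuallyEq ?_
      filter_upwards [h0] with y hy
      simp [hy]
  have hGc : HasCompactSupport fun y => f y • w y := hc.smul_right
  have h1 : ∫ x in Ω, divergence (fun y => f y • w y) x = 0 := by
    rw [setIntegral_eq_integral_of_forall_compl_eq_zero, integral_divergence_eq_zero hG hGc]
    intro x hx
    have : x ∉ tsupport fun y => f y • w y := fun h => hx (hs (tsupport_smul_subset_left f w h))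
    have h0 : fderiv ℝ (fun y => f y • w y) x = 0 := by
      by_contra h
      exact this (support_fderiv_subset ℝ (f := fun y => f y • w y) h)
    rw [divergence, h0]
    exact map_zero _
  rw [← h1]
  refine setIntegral_congr_fun hΩ.measurableSet fun x hx => ?_
  exact (divergence_smul (hf.differentiable one_ne_zero x)
    ((hw.contDiffAt (hΩ.mem_nhds hx)).differentiableAt one_ne_zero)).symm

/-! ### Continuous families of `C²` fields -/

theorem IsContinuousC2Field.tendstoUniformlyOn {d : ℕ} {Ω : Set (Space d)} {T : ℝ}
    {v : ℝ → Space d → Space d} (hv : IsContinuousC2Field Ω T v) {t : ℝ} (ht : t ∈ Icc 0 T) :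
    TendstoUniformlyOn v (v t) (𝓝[Icc 0 T] t) Ω := by
  have h := ((hv t ht).2 0 (Nat.zero_le 2)).2
  rw [Metric.tendstoUniformlyOn_iff] at h ⊢
  intro ε hε
  filter_upwards [h ε hε] with s hs x hx
  have := hs x hx
  simpa only [iteratedFDeriv_zero_eq_comp, Function.comp, LinearIsometryEquiv.dist_map] using this

/-- Uniform convergence carries the bound for `v t` over to nearby times at the cost of `1`;
compactness of `[0,T]` leaves finitely many such bounds. -/
theorem IsContinuousC2Field.exists_bound {d : ℕ} {Ω : Set (Space d)} {T : ℝ}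
    {v : ℝ → Space d → Space d} (hv : IsContinuousC2Field Ω T v) :
    ∃ C : ℝ, ∀ t ∈ Icc 0 T, ∀ x ∈ Ω, ‖v t x‖ ≤ C := by
  refine isCompact_Icc.induction_on (p := fun S => ∃ C : ℝ, ∀ t ∈ S, ∀ x ∈ Ω, ‖v t x‖ ≤ C)
    ⟨0, by simp⟩ (fun S S' h ⟨C, hC⟩ => ⟨C, fun t ht => hC t (h ht)⟩)
    (fun S S' ⟨C, hC⟩ ⟨C', hC'⟩ => ⟨max C C', ?_⟩) fun t ht => ?_
  · rintro t (h | h) x hx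
    · exact (hC t h x hx).trans (le_max_left _ _)
    · exact (hC' t h x hx).trans (le_max_right _ _)
  · obtain ⟨C, hC⟩ := ((hv t ht).2 0 (Nat.zero_le 2)).1
    refine ⟨_, Metric.tendstoUniformlyOn_iff.1 (hv.tendstoUniformlyOn ht) 1 one_pos, C + 1, ?_⟩
    intro s hs x hx
    have h1 := hC x hx
    rw [norm_iteratedFDeriv_zero] at h1
    have h2 := hs x hx
    rw [dist_eq_norm, norm_sub_rev] at h2
    have h3 := norm_le_norm_add_norm_sub' (v s x) (v t x)
    linarith

/-- Joint continuity, from convergence uniform in `x` and continuity at a fixed time. It supplies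
the measurability of the velocity on `Q_T`. -/
theorem IsContinuousC2Field.continuousOn {d : ℕ} {Ω : Set (Space d)} {T : ℝ}
    {v : ℝ → Space d → Space d} (hv : IsContinuousC2Field Ω T v) :
    ContinuousOn (fun p : SpaceTime d => v p.2 p.1) (Ω ×ˢ Icc 0 T) := by
  rintro ⟨x, t⟩ ⟨hx, ht⟩
  rw [Metric.continuousWithinAt_iff']
  intro ε hε
  have h1 := Metric.tendstoUniformlyOn_iff.1 (hv.tendstoUniformlyOn ht) (ε / 2) (half_pos hε)
  have h2 := Metric.continuousWithinAt_iff'.1 ((hv t ht).1.continuousOn x hx) (ε / 2) (half_pos hε)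
  rw [nhdsWithin_prod_eq]
  filter_upwards [h2.prod_mk h1, prod_mem_prod self_mem_nhdsWithin self_mem_nhdsWithin]
    with p hp hp'
  have h3 := hp.2 p.1 hp'.1
  have h4 := hp.1
  rw [dist_comm] at h3
  calc dist (v p.2 p.1) (v t x) ≤ dist (v p.2 p.1) (v t p.1) + dist (v t p.1) (v t x) :=
        dist_triangle _ _ _
    _ < ε := by linarith

/-! ### Integration over time slices: skew-symmetry of the transport term and Poincaré's inequality.
-/

namespace MovingDomain

variable {d : ℕ} {D : MovingDomain d}

theorem volume_restrict_Q : (volume : Measure (SpaceTime d)).restrict (D.Q : Set (SpaceTime d)) =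
    (volume.restrict (D.Ω : Set (Space d))).prod (volume.restrict (Ioo 0 D.T)) := by
  rw [Measure.prod_restrict]
  rfl

/-- Fubini's theorem on `Q_T`. -/
theorem integral_Q_eq {E : Type*} [NormedAddCommGroup E] [NormedSpace ℝ E] {F : SpaceTime d → E}
    (hF : IntegrableOn F (D.Q : Set (SpaceTime d))) :
    ∫ p in (D.Q : Set (SpaceTime d)), F p = ∫ t in Ioo 0 D.T, ∫ x in (D.Ω : Set (Space d)),
      F (x, t) := by
  rw [IntegrableOn, volume_restrict_Q] at hF
  rw [volume_restrict_Q, integral_prod_symm _ hF]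

/-- No integrability is assumed: the integral of a non-integrable function is `0` by convention. -/
theorem integral_Q_eq_zero {F : SpaceTime d → ℝ}
    (h : ∀ t ∈ Ioo 0 D.T, ∫ x in (D.Ω : Set (Space d)), F (x, t) = 0) :
    ∫ p in (D.Q : Set (SpaceTime d)), F p = 0 := by
  by_cases hF : IntegrableOn F (D.Q : Set (SpaceTime d))
  · rw [integral_Q_eq hF, setIntegral_congr_fun measurableSet_Ioo h, integral_zero]
  · exact integral_undef hF

theorem contDiff_slice (φ : D.Test) (t : ℝ) : ContDiff ℝ 1 fun x => φ (x, t) :=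
  (contDiff_test φ).comp (contDiff_prodMk_left t)

theorem tsupport_slice_subset (φ : D.Test) (t : ℝ) :
    tsupport (fun x => φ (x, t)) ⊆ (fun x => (x, t)) ⁻¹' tsupport φ :=
  tsupport_comp_subset_preimage (φ : SpaceTime d → ℝ) (by fun_prop)

theorem hasCompactSupport_slice (φ : D.Test) (t : ℝ) : HasCompactSupport fun x => φ (x, t) := by
  refine HasCompactSupport.of_support_subset_isCompact (φ.hasCompactSupport.image continuous_fst)
    fun x hx => ⟨(x, t), subset_tsupport _ hx, rfl⟩

/-- The divergence theorem for `φ² w` on one time slice. With `w = v t` it gives the skew-symmetry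
of transport, with `w = id` the Poincaré inequality. -/
theorem setIntegral_slice_eq_zero (φ : D.Test) (t : ℝ) {w : Space d → Space d}
    (hw : ContDiffOn ℝ 1 w D.Ω) :
    ∫ x in (D.Ω : Set (Space d)),
      (2 * (inner ℝ (w x) (spaceGrad φ (x, t)) * φ (x, t)) + φ (x, t) ^ 2 * divergence w x) = 0 := by
  have hφ := contDiff_slice φ t
  have hsub : tsupport (fun x => φ (x, t) ^ 2) ⊆ tsupport fun x => φ (x, t) := by
    refine closure_mono fun x hx => ?_
    rw [Function.mem_support] at hx ⊢
    exact fun h => hx (by simp [h])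
  have h := setIntegral_inner_gradient_add D.Ω.isOpen (hφ.pow 2)
    (HasCompactSupport.mono' (hasCompactSupport_slice φ t) (subset_closure.trans hsub))
    (fun x hx => fst_mem_of_mem_tsupport φ (tsupport_slice_subset φ t (hsub hx))) hw
  rw [← h]
  congr 1 with x
  have h1 : gradient (fun x => φ (x, t) ^ 2) x = (2 * φ (x, t)) • spaceGrad φ (x, t) := by
    have := ((hφ.differentiable one_ne_zero x).hasFDerivAt.pow 2)
    simp only [spaceGrad, gradient]
    rw [this.fderiv]
    simp
  rw [h1, inner_smul_right]
  ring

/-- The transport term is skew-symmetric. -/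
theorem integral_transport_eq_zero (φ : D.Test) :
    ∫ p in (D.Q : Set (SpaceTime d)), inner ℝ (D.v p.2 p.1) (spaceGrad φ p) * φ p = 0 := by
  refine integral_Q_eq_zero fun t ht => ?_
  have ht' : t ∈ Icc 0 D.T := Ioo_subset_Icc_self ht
  have h := setIntegral_slice_eq_zero φ t ((D.v_regular t ht').1.of_le one_le_two)
  have h2 : ∫ x in (D.Ω : Set (Space d)), 2 * (inner ℝ (D.v t x) (spaceGrad φ (x, t)) * φ (x, t)) =
      0 := by
    rw [← h]
    refine setIntegral_congr_fun D.Ω.isOpen.measurableSet fun x hx => ?_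
    simp only [D.v_div t ht' x hx, mul_zero, add_zero]
  rw [integral_const_mul] at h2
  linarith

theorem divergence_id (x : Space d) : divergence (fun y => y) x = d := by
  rw [divergence, fderiv_fun_id]
  exact (LinearMap.trace_id ℝ (Space d)).trans (by simp)

variable (D) in
/-- The Poincaré inequality. -/
theorem exists_poincare (hd : 0 < d) :
    ∃ C : ℝ, 0 ≤ C ∧ ∀ φ : D.Test, ‖fnL2 φ‖ ≤ C * ‖gradL2 φ‖ := by
  obtain ⟨R, hR⟩ := D.bounded.exists_norm_le
  have hR0 : 0 ≤ |R| := abs_nonneg R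
  -- The field `w(x) = x` has divergence `d`, so `d ‖φ‖² = -2 ∫ (x · ∇φ) φ ≤ 2 |R| ‖∇φ‖ ‖φ‖`, and `d
  -- ≥ 1`.
  refine ⟨2 * |R|, by positivity, fun φ => ?_⟩
  have hφ := contDiff_test φ
  have hd' : (1 : ℝ) ≤ d := by exact_mod_cast hd
  have hcx : Continuous fun p : SpaceTime d => inner ℝ p.1 (spaceGrad φ p) :=
    continuous_fst.inner (continuous_spaceGrad hφ)
  have hi1 : Integrable fun p : SpaceTime d => inner ℝ p.1 (spaceGrad φ p) * φ p :=
    (hcx.mul φ.continuous).integrable_of_hasCompactSupport φ.hasCompactSupport.mul_left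
  have hi2 : Integrable fun p : SpaceTime d => φ p ^ 2 := by
    simp only [pow_two]
    exact (φ.continuous.mul φ.continuous).integrable_of_hasCompactSupport
      φ.hasCompactSupport.mul_left
  have h0 : ∫ p in (D.Q : Set (SpaceTime d)),
      (2 * (inner ℝ p.1 (spaceGrad φ p) * φ p) + φ p ^ 2 * d) = 0 := by
    refine integral_Q_eq_zero fun t _ => ?_
    have := setIntegral_slice_eq_zero φ t (contDiff_id (𝕜 := ℝ) (E := Space d)).contDiffOn
    rw [← this]
    refine setIntegral_congr_fun D.Ω.isOpen.measurableSet fun x _ => ?_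
    simp only [id_eq]
    rw [← divergence_id x]
    rfl
  rw [integral_add (hi1.const_mul 2).integrableOn (hi2.mul_const _).integrableOn,
    integral_const_mul, integral_mul_const] at h0
  have hn1 : ‖fnL2 φ‖ ^ 2 = ∫ p in (D.Q : Set (SpaceTime d)), φ p ^ 2 := by
    refine (norm_toLp_sq (memLp_fn φ)).trans ?_
    simp only [Real.norm_eq_abs, sq_abs]
  have hmem : MemLp (fun p => inner ℝ p.1 (spaceGrad φ p)) 2
      (volume.restrict (D.Q : Set (SpaceTime d))) :=
    memLp_of_hasCompactSupport hcx
      ((hasCompactSupport_spaceGrad hφ φ.hasCompactSupport).mono fun p hp h => hp (by simp [h]))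
  have hle : ‖hmem.toLp _‖ ≤ |R| * ‖gradL2 φ‖ := by
    refine Lp.norm_le_mul_norm_of_ae_le_mul ?_
    filter_upwards [hmem.coeFn_toLp, (memLp_spaceGrad φ).coeFn_toLp,
      self_mem_ae_restrict D.Q.isOpen.measurableSet] with p h1 h2 h3
    rw [h1]
    change _ ≤ _ * ‖(memLp_spaceGrad φ).toLp _ p‖
    rw [h2]
    refine (norm_inner_le_norm _ _).trans ?_
    have : ‖p.1‖ ≤ |R| := (hR _ h3.1).trans (le_abs_self R)
    gcongr
  have h3 : |∫ p in (D.Q : Set (SpaceTime d)), inner ℝ p.1 (spaceGrad φ p) * φ p| ≤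
      ‖hmem.toLp _‖ * ‖fnL2 φ‖ := by
    have := inner_toLp hmem (memLp_fn φ)
    have e : (∫ p in (D.Q : Set (SpaceTime d)), inner ℝ p.1 (spaceGrad φ p) * φ p) =
        inner ℝ (hmem.toLp _) (fnL2 φ) := by
      refine Eq.trans ?_ this.symm
      congr 1 with p
      exact mul_comm _ _
    rw [e]
    exact abs_real_inner_le_norm _ _
  have h4 : ‖fnL2 φ‖ ^ 2 ≤ 2 * |R| * ‖gradL2 φ‖ * ‖fnL2 φ‖ := by
    have h5 := neg_abs_le (∫ p in (D.Q : Set (SpaceTime d)), inner ℝ p.1 (spaceGrad φ p) * φ p)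
    have h6 := mul_le_mul_of_nonneg_right hle (norm_nonneg (fnL2 φ))
    rw [← hn1] at h0
    nlinarith [sq_nonneg ‖fnL2 φ‖]
  by_cases hz : ‖fnL2 φ‖ = 0
  · rw [hz]
    positivity
  · have hpos : 0 < ‖fnL2 φ‖ := lt_of_le_of_ne (norm_nonneg _) (Ne.symm hz)
    rw [pow_two] at h4
    exact le_of_mul_le_mul_right h4 hpos

/-! ### The spatial part of the bilinear form -/

variable (D) in
theorem exists_norm_velocity_le :
    ∃ C : ℝ, ∀ᵐ p ∂(volume : Measure (SpaceTime d)).restrict (D.Q : Set (SpaceTime d)),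
      ‖D.v p.2 p.1‖ ≤ C := by
  obtain ⟨C, hC⟩ := D.v_regular.exists_bound
  refine ⟨C, ?_⟩
  filter_upwards [self_mem_ae_restrict D.Q.isOpen.measurableSet] with p hp
  exact hC p.2 (Ioo_subset_Icc_self hp.2) p.1 hp.1

variable (D) in
theorem memLp_velocity : MemLp (fun p : SpaceTime d => D.v p.2 p.1) ∞
    (volume.restrict (D.Q : Set (SpaceTime d))) := by
  obtain ⟨C, hC⟩ := D.exists_norm_velocity_le
  refine memLp_top_of_bound ?_ C hC
  exact (D.v_regular.continuousOn.mono (prod_mono_right Ioo_subset_Icc_self)).aestronglyMeasurable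
    D.Q.isOpen.measurableSet

variable (D) in
theorem measurable_diffusion (κ₁ κ₂ : ℝ) : Measurable (D.diffusion κ₁ κ₂) := by
  unfold diffusion
  exact Measurable.ite D.isOpen_tube₁.measurableSet measurable_const measurable_const

variable (D) in
theorem memLp_diffusion (κ₁ κ₂ : ℝ) :
    MemLp (D.diffusion κ₁ κ₂) ∞ (volume.restrict (D.Q : Set (SpaceTime d))) := by
  refine memLp_top_of_bound (D.measurable_diffusion κ₁ κ₂).aestronglyMeasurable
    (max ‖κ₁‖ ‖κ₂‖) (Eventually.of_forall fun p => ?_)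
  unfold diffusion
  split_ifs
  · exact le_max_left _ _
  · exact le_max_right _ _

theorem min_le_diffusion (κ₁ κ₂ : ℝ) (p : SpaceTime d) : min κ₁ κ₂ ≤ D.diffusion κ₁ κ₂ p := by
  unfold diffusion
  split_ifs
  · exact min_le_left _ _
  · exact min_le_right _ _

variable (D) in
/-- The map `u ↦ u` from `Y` to `L²(Q_T)`. -/
def fnCLM : D.Y →L[ℝ] L2 (D.Q : Set (SpaceTime d)) :=
  (WithLp.fstL 2 ℝ _ _).comp D.Y.subtypeL

variable (D) in
/-- The map `u ↦ ∇u` from `Y` to `L²(Q_T; ℝ^d)`. -/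
def gradCLM : D.Y →L[ℝ] L2Vec (D.Q : Set (SpaceTime d)) :=
  (WithLp.sndL 2 ℝ _ _).comp D.Y.subtypeL

variable (D) in
/-- The map `u ↦ v · ∇u` from `Y` to `L²(Q_T)`. -/
def transport : D.Y →L[ℝ] L2 (D.Q : Set (SpaceTime d)) :=
  ((innerSL ℝ).holderL (volume.restrict (D.Q : Set (SpaceTime d))) ∞ 2 2
    (D.memLp_velocity.toLp _)).comp D.gradCLM

variable (D) in
/-- The map `u ↦ κ ∇u` from `Y` to `L²(Q_T; ℝ^d)`. -/
def flux (κ₁ κ₂ : ℝ) : D.Y →L[ℝ] L2Vec (D.Q : Set (SpaceTime d)) :=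
  ((ContinuousLinearMap.lsmul ℝ ℝ).holderL (volume.restrict (D.Q : Set (SpaceTime d))) ∞ 2 2
    ((D.memLp_diffusion κ₁ κ₂).toLp _)).comp D.gradCLM

theorem coeFn_transport (u : D.Y) :
    D.transport u =ᵐ[volume.restrict (D.Q : Set (SpaceTime d))]
      fun p => inner ℝ (D.v p.2 p.1) (D.grad u p) := by
  filter_upwards [(innerSL ℝ).coeFn_holder (r := 2) (D.memLp_velocity.toLp _) (D.grad u),
    D.memLp_velocity.coeFn_toLp] with p h1 h2
  refine h1.trans ?_
  rw [h2]
  rfl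

theorem coeFn_flux (κ₁ κ₂ : ℝ) (u : D.Y) :
    D.flux κ₁ κ₂ u =ᵐ[volume.restrict (D.Q : Set (SpaceTime d))]
      fun p => D.diffusion κ₁ κ₂ p • D.grad u p := by
  filter_upwards [(ContinuousLinearMap.lsmul ℝ ℝ).coeFn_holder (r := 2)
    ((D.memLp_diffusion κ₁ κ₂).toLp _) (D.grad u),
    (D.memLp_diffusion κ₁ κ₂).coeFn_toLp] with p h1 h2
  refine h1.trans ?_
  rw [h2]
  rfl

variable (D) in
/-- The bilinear form `∫_{Q_T} (v · ∇u) φ + κ ∇u · ∇φ` on `Y × Y`. -/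
def spaceForm (κ₁ κ₂ : ℝ) : D.Y →L[ℝ] D.Y →L[ℝ] ℝ :=
  (innerSL ℝ).bilinearComp D.transport D.fnCLM +
    (innerSL ℝ).bilinearComp (D.flux κ₁ κ₂) D.gradCLM

theorem spaceForm_apply (κ₁ κ₂ : ℝ) (u φ : D.Y) : D.spaceForm κ₁ κ₂ u φ =
    inner ℝ (D.transport u) (D.toFn φ) + inner ℝ (D.flux κ₁ κ₂ u) (D.grad φ) := rfl

theorem spaceForm_eq (κ₁ κ₂ : ℝ) (u φ : D.Y) : D.spaceForm κ₁ κ₂ u φ =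
    ∫ p in (D.Q : Set (SpaceTime d)), (inner ℝ (D.v p.2 p.1) (D.grad u p) * D.toFn φ p +
      D.diffusion κ₁ κ₂ p * inner ℝ (D.grad u p) (D.grad φ p)) := by
  rw [spaceForm_apply, L2.inner_def, L2.inner_def, ← integral_add (L2.integrable_inner _ _)
    (L2.integrable_inner _ _)]
  refine integral_congr_ae ?_
  filter_upwards [coeFn_transport u, coeFn_flux κ₁ κ₂ u] with p h1 h2
  rw [h1, h2, real_inner_smul_left]
  congr 1
  exact mul_comm _ _

theorem form_eq (κ₁ κ₂ : ℝ) (u : D.X) (φ : D.Y) :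
    D.form κ₁ κ₂ u φ = D.dt u φ + D.spaceForm κ₁ κ₂ u.1 φ := by
  rw [spaceForm_eq]
  rfl

theorem norm_sq_Y (u : D.Y) : ‖u‖ ^ 2 = ‖D.toFn u‖ ^ 2 + ‖D.grad u‖ ^ 2 :=
  WithLp.prod_norm_sq_eq_of_L2 (u : D.Pair)

theorem inner_transport_toFn (φ : D.Test) :
    inner ℝ (D.transport (toY φ)) (D.toFn (toY φ)) = 0 := by
  rw [L2.inner_def, ← integral_transport_eq_zero φ]
  refine integral_congr_ae ?_
  filter_upwards [coeFn_transport (toY φ), (memLp_fn φ).coeFn_toLp,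
    (memLp_spaceGrad φ).coeFn_toLp] with p h1 h2 h3
  have h2' : D.toFn (toY φ) p = φ p := h2
  have h3' : D.grad (toY φ) p = spaceGrad φ p := h3
  rw [h1, h2', h3']
  exact mul_comm _ _

theorem inner_flux_grad (κ₁ κ₂ : ℝ) (u : D.Y) :
    min κ₁ κ₂ * ‖D.grad u‖ ^ 2 ≤ inner ℝ (D.flux κ₁ κ₂ u) (D.grad u) := by
  rw [← real_inner_self_eq_norm_sq, L2.inner_def, L2.inner_def, ← integral_const_mul]
  refine integral_mono_ae ((L2.integrable_inner _ _).const_mul _) (L2.integrable_inner _ _) ?_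
  filter_upwards [coeFn_flux κ₁ κ₂ u] with p h
  rw [h, real_inner_smul_left]
  exact mul_le_mul_of_nonneg_right (min_le_diffusion κ₁ κ₂ p) real_inner_self_nonneg

/-- Inequalities between continuous functions on `Y` follow from those for test functions. -/
theorem le_of_forall_test {f g : D.Y → ℝ} (hf : Continuous f) (hg : Continuous g)
    (h : ∀ φ : 𝓓^{1}(D.Q, ℝ), f (toY (ofQ φ)) ≤ g (toY (ofQ φ))) (u : D.Y) : f u ≤ g u :=
  D.denseRange_toY_ofQ.induction_on u (isClosed_le hf hg) h

theorem eq_of_forall_test {f g : D.Y → ℝ} (hf : Continuous f) (hg : Continuous g)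
    (h : ∀ φ : 𝓓^{1}(D.Q, ℝ), f (toY (ofQ φ)) = g (toY (ofQ φ))) (u : D.Y) : f u = g u :=
  D.denseRange_toY_ofQ.induction_on u (isClosed_eq hf hg) h

variable (D) in
/-- The bilinear form is coercive on `Y`. -/
theorem exists_coercive (hd : 0 < d) {κ₁ κ₂ : ℝ} (hκ₁ : 0 < κ₁) (hκ₂ : 0 < κ₂) :
    ∃ c : ℝ, 0 < c ∧ ∀ u : D.Y, c * ‖u‖ ^ 2 ≤ D.spaceForm κ₁ κ₂ u u := by
  obtain ⟨C, hC0, hC⟩ := D.exists_poincare hd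
  have hκ : 0 < min κ₁ κ₂ := lt_min hκ₁ hκ₂
  -- By Poincaré, `‖u‖² = ‖u‖²_{L²} + ‖∇u‖² ≤ (C ^ 2 + 1) ‖∇u‖²`. Both sides of the claim are
  -- continuous in `u`, so test functions suffice, and for them the transport term drops out.
  refine ⟨min κ₁ κ₂ / (C ^ 2 + 1), by positivity, ?_⟩
  refine le_of_forall_test (by fun_prop) ?_ fun ψ => ?_
  · exact (D.spaceForm κ₁ κ₂).continuous.clm_apply continuous_id
  · set φ := ofQ ψ
    rw [spaceForm_apply, inner_transport_toFn, zero_add]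
    refine le_trans ?_ (inner_flux_grad κ₁ κ₂ _)
    rw [norm_sq_Y, div_mul_eq_mul_div, div_le_iff₀ (by positivity), mul_assoc]
    refine mul_le_mul_of_nonneg_left ?_ hκ.le
    have h1 : ‖D.toFn (toY φ)‖ ^ 2 ≤ (C * ‖D.grad (toY φ)‖) ^ 2 :=
      pow_le_pow_left₀ (norm_nonneg _) (hC φ) 2
    nlinarith

end MovingDomain

/-! ### Steklov averages in time -/

instance isAddRightInvariant_volume (d : ℕ) :
    (volume : Measure (SpaceTime d)).IsAddRightInvariant :=
  inferInstanceAs (((volume : Measure (Space d)).prod (volume : Measure ℝ)).IsAddRightInvariant)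

/-- The average of `f` over the time interval between `t - h` and `t`. -/
def steklov {d : ℕ} {E : Type*} [NormedAddCommGroup E] [NormedSpace ℝ E] (h : ℝ)
    (f : SpaceTime d → E) (p : SpaceTime d) : E :=
  ∫ σ in (0 : ℝ)..1, f (p - (0, h * σ))

section Steklov

variable {d : ℕ} {E : Type*} [NormedAddCommGroup E]

theorem continuous_uncurry_steklov {f : SpaceTime d → E} (hf : Continuous f) (h : ℝ) :
    Continuous (Function.uncurry fun (p : SpaceTime d) (σ : ℝ) => f (p - (0, h * σ))) := by
  unfold Function.uncurry
  fun_prop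

/-- A compact set containing the support of `steklov h f`. -/
def steklovSupport (h : ℝ) (f : SpaceTime d → E) : Set (SpaceTime d) :=
  (fun q : SpaceTime d × ℝ => q.1 + (0, h * q.2)) '' (tsupport f ×ˢ Icc 0 1)

theorem isCompact_steklovSupport {f : SpaceTime d → E} (hc : HasCompactSupport f) (h : ℝ) :
    IsCompact (steklovSupport h f) :=
  (hc.isCompact.prod isCompact_Icc).image (by fun_prop)

section NormedSpace

variable [NormedSpace ℝ E]

theorem continuous_steklov {f : SpaceTime d → E} (hf : Continuous f) (h : ℝ) :
    Continuous (steklov h f) :=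
  intervalIntegral.continuous_parametric_intervalIntegral_of_continuous'
    (continuous_uncurry_steklov hf h) 0 1

theorem support_steklov_subset (h : ℝ) (f : SpaceTime d → E) :
    Function.support (steklov h f) ⊆ steklovSupport h f := by
  intro p hp
  by_contra hc
  refine hp ((intervalIntegral.integral_congr (g := fun _ => (0 : E)) fun σ hσ => ?_).trans
    (by simp))
  rw [uIcc_of_le zero_le_one] at hσ
  by_contra hne
  exact hc ⟨(p - (0, h * σ), σ), ⟨subset_tsupport f hne, hσ⟩, sub_add_cancel _ _⟩

theorem tsupport_steklov_subset {f : SpaceTime d → E} (hc : HasCompactSupport f) (h : ℝ) :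
    tsupport (steklov h f) ⊆ steklovSupport h f :=
  closure_minimal (support_steklov_subset h f) (isCompact_steklovSupport hc h).isClosed

theorem hasCompactSupport_steklov {f : SpaceTime d → E} (hc : HasCompactSupport f) (h : ℝ) :
    HasCompactSupport (steklov h f) :=
  .of_support_subset_isCompact (isCompact_steklovSupport hc h) (support_steklov_subset h f)

theorem hasFDerivAt_steklov {φ : SpaceTime d → ℝ} (hφ : ContDiff ℝ 1 φ)
    (hc : HasCompactSupport φ) (h : ℝ) (p : SpaceTime d) :
    HasFDerivAt (steklov h φ) (steklov h (fderiv ℝ φ) p) p := by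
  have hd := hφ.continuous_fderiv one_ne_zero
  obtain ⟨C, hC⟩ := hd.bounded_above_of_compact_support (hc.fderiv ℝ)
  have h1 : ∀ q : SpaceTime d, Continuous fun σ : ℝ => φ (q - (0, h * σ)) := fun q =>
    hφ.continuous.comp (by fun_prop)
  have h2 : Continuous fun σ : ℝ => fderiv ℝ φ (p - (0, h * σ)) := hd.comp (by fun_prop)
  refine intervalIntegral.hasFDerivAt_integral_of_dominated_of_fderiv_le (bound := fun _ => C)
    (F' := fun q σ => fderiv ℝ φ (q - (0, h * σ))) univ_mem
    (Eventually.of_forall fun q => (h1 q).aestronglyMeasurable) ((h1 p).intervalIntegrable _ _)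
    h2.aestronglyMeasurable (Eventually.of_forall fun σ _ q _ => hC _)
    intervalIntegrable_const (Eventually.of_forall fun σ _ q _ => ?_)
  rw [← fderiv_comp_sub]
  exact ((hφ.comp (contDiff_id.sub contDiff_const)).differentiable one_ne_zero q).hasFDerivAt

theorem contDiff_steklov {φ : SpaceTime d → ℝ} (hφ : ContDiff ℝ 1 φ)
    (hc : HasCompactSupport φ) (h : ℝ) : ContDiff ℝ 1 (steklov h φ) := by
  rw [contDiff_one_iff_fderiv]
  refine ⟨fun p => (hasFDerivAt_steklov hφ hc h p).differentiableAt, ?_⟩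
  rw [show fderiv ℝ (steklov h φ) = steklov h (fderiv ℝ φ) from
    funext fun p => (hasFDerivAt_steklov hφ hc h p).fderiv]
  exact continuous_steklov (hφ.continuous_fderiv one_ne_zero) h

theorem spaceGrad_steklov {φ : SpaceTime d → ℝ} (hφ : ContDiff ℝ 1 φ)
    (hc : HasCompactSupport φ) (h : ℝ) : spaceGrad (steklov h φ) = steklov h (spaceGrad φ) := by
  funext p
  -- The passage from the space-time derivative to the spatial gradient, as a continuous linear map,
  -- commutes with the integral over `σ`.
  let A : (SpaceTime d →L[ℝ] ℝ) →L[ℝ] Space d :=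
    { toFun := fun B => (InnerProductSpace.toDual ℝ (Space d)).symm
        (B.comp (ContinuousLinearMap.inl ℝ (Space d) ℝ))
      map_add' := fun B B' => by rw [ContinuousLinearMap.add_comp, map_add]
      map_smul' := fun c B => by simp [ContinuousLinearMap.smul_comp]
      cont := (LinearIsometryEquiv.continuous _).comp (continuous_id.clm_comp continuous_const) }
  have hA : ∀ q, spaceGrad φ q = A (fderiv ℝ φ q) := spaceGrad_eq hφ
  rw [spaceGrad_eq (contDiff_steklov hφ hc h), (hasFDerivAt_steklov hφ hc h p).fderiv]
  have hi : IntervalIntegrable (fun σ : ℝ => fderiv ℝ φ (p - (0, h * σ))) volume 0 1 :=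
    Continuous.intervalIntegrable ((hφ.continuous_fderiv one_ne_zero).comp (by fun_prop)) _ _
  have := A.intervalIntegral_comp_comm hi
  simp only [← hA] at this
  exact this.symm

/-- The average is `1/h` times a time integral over `[t - h, t]`, so differentiating it leaves a
difference quotient. Negative `h` is included; it corresponds to averaging forward in time. -/
theorem timeDiff_steklov {φ : SpaceTime d → ℝ} (hφ : ContDiff ℝ 1 φ)
    (hc : HasCompactSupport φ) {h : ℝ} (hh : h ≠ 0) (p : SpaceTime d) :
    timeDiff (steklov h φ) p = h⁻¹ * (φ p - φ (p - (0, h))) := by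
  rw [timeDiff_eq (contDiff_steklov hφ hc h), (hasFDerivAt_steklov hφ hc h p).fderiv, steklov]
  have hi : IntervalIntegrable (fun σ : ℝ => fderiv ℝ φ (p - (0, h * σ))) volume 0 1 :=
    Continuous.intervalIntegrable ((hφ.continuous_fderiv one_ne_zero).comp (by fun_prop)) _ _
  rw [ContinuousLinearMap.intervalIntegral_apply hi]
  -- The integrand is an exact derivative in `σ`; the endpoints `σ = 0, 1` give the two terms of the
  -- quotient.
  have hder : ∀ σ ∈ uIcc (0 : ℝ) 1, HasDerivAt (fun σ : ℝ => -h⁻¹ * φ (p - (0, h * σ)))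
      (fderiv ℝ φ (p - (0, h * σ)) (0, 1)) σ := by
    intro σ _
    have h1 : HasDerivAt (fun σ : ℝ => p - ((0 : Space d), h * σ)) (-((0 : Space d), h * 1)) σ :=
      ((hasDerivAt_const σ (0 : Space d)).prodMk ((hasDerivAt_id σ).const_mul h)).const_sub p
    have h2 := ((hφ.differentiable one_ne_zero (p - (0, h * σ))).hasFDerivAt.comp_hasDerivAt σ
      h1).const_mul (-h⁻¹)
    have h3 : (-((0 : Space d), h * 1) : SpaceTime d) = (-h) • (0, 1) := by simp
    have h4 : fderiv ℝ φ (p - (0, h * σ)) (0, 1) =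
        -h⁻¹ * fderiv ℝ φ (p - (0, h * σ)) (-((0 : Space d), h * 1)) := by
      rw [h3, map_smul, smul_eq_mul]
      field_simp
    rw [h4]
    exact h2
  rw [intervalIntegral.integral_eq_sub_of_hasDerivAt hder
    (Continuous.intervalIntegrable (((hφ.continuous_fderiv one_ne_zero).comp
      (by fun_prop)).clm_apply continuous_const) _ _)]
  rw [mul_one, mul_zero, show ((0 : Space d), (0 : ℝ)) = 0 from rfl, sub_zero]
  ring

theorem exists_steklov_sub_le {f : SpaceTime d → E} (hf : Continuous f)
    (hc : HasCompactSupport f) [CompleteSpace E] {ε : ℝ} (hε : 0 < ε) :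
    ∃ δ > 0, ∀ h : ℝ, |h| < δ → ∀ p, ‖steklov h f p - f p‖ ≤ ε := by
  obtain ⟨δ, hδ, hu⟩ := Metric.uniformContinuous_iff.1 (hc.uniformContinuous_of_continuous hf) ε hε
  refine ⟨δ, hδ, fun h hh p => ?_⟩
  have h1 : steklov h f p - f p = ∫ σ in (0 : ℝ)..1, (f (p - (0, h * σ)) - f p) := by
    rw [intervalIntegral.integral_sub]
    · simp [steklov]
    · exact Continuous.intervalIntegrable (hf.comp (by fun_prop)) _ _
    · exact intervalIntegrable_const
  rw [h1]
  have h2 := intervalIntegral.norm_integral_le_of_norm_le_const (a := 0) (b := 1) (C := ε)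
    (f := fun σ : ℝ => f (p - (0, h * σ)) - f p) fun σ hσ => ?_
  · simpa using h2
  · rw [uIoc_of_le zero_le_one] at hσ
    rw [← dist_eq_norm]
    refine (hu ?_).le
    rw [dist_eq_norm, sub_sub_cancel_left, norm_neg, Prod.norm_mk, norm_zero,
      max_eq_right (norm_nonneg _), norm_mul, Real.norm_eq_abs, Real.norm_eq_abs,
      abs_of_pos hσ.1]
    exact (mul_le_of_le_one_right (abs_nonneg h) hσ.2).trans_lt hh

end NormedSpace

theorem integrable_norm_sq {f : SpaceTime d → E} (hf : Continuous f)
    (hfc : HasCompactSupport f) : Integrable fun p => ‖f p‖ ^ 2 :=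
  (hf.norm.pow 2).integrable_of_hasCompactSupport
    (hfc.mono fun p hp h => hp (by simp [h]))

section InnerProduct

variable [InnerProductSpace ℝ E] [CompleteSpace E]

theorem integral_inner_steklov {f g : SpaceTime d → E} (hf : Continuous f) (hg : Continuous g)
    (hgc : HasCompactSupport g) (h : ℝ) :
    ∫ p, inner ℝ (g p) (steklov h f p) =
      ∫ σ in (0 : ℝ)..1, ∫ p, inner ℝ (g p) (f (p - (0, h * σ))) := by
  have hcont := continuous_uncurry_steklov hf h
  have hF : Continuous (Function.uncurry fun (p : SpaceTime d) (σ : ℝ) =>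
      inner ℝ (g p) (f (p - (0, h * σ)))) :=
    (hg.comp continuous_fst).inner hcont
  have hint : IntegrableOn (Function.uncurry fun (p : SpaceTime d) (σ : ℝ) =>
      inner ℝ (g p) (f (p - (0, h * σ)))) (univ ×ˢ Ioc 0 1) := by
    -- Fubini needs compact support of `g` only: the integrand vanishes off `tsupport g ×ˢ Icc 0 1`.
    refine IntegrableOn.of_forall_sdiff_eq_zero (s := tsupport g ×ˢ Icc 0 1)
      (hF.continuousOn.integrableOn_compact (hgc.isCompact.prod isCompact_Icc))
      (MeasurableSet.univ.prod measurableSet_Ioc) ?_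
    rintro ⟨p, σ⟩ ⟨⟨_, hσ⟩, hn⟩
    have : p ∉ tsupport g := fun hp => hn ⟨hp, Ioc_subset_Icc_self hσ⟩
    simp [Function.uncurry, image_eq_zero_of_notMem_tsupport this]
  rw [IntegrableOn, Measure.volume_eq_prod, ← Measure.prod_restrict, Measure.restrict_univ] at hint
  rw [intervalIntegral.integral_of_le zero_le_one, ← integral_integral_swap hint]
  congr 1 with p
  rw [steklov, intervalIntegral.integral_of_le zero_le_one, integral_inner]
  exact (Continuous.integrableOn_Icc (hf.comp (by fun_prop))).mono_set Ioc_subset_Icc_self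

/-- The averages over `[t - h, t]` and `[t, t + h]` are adjoint to each other. -/
theorem integral_inner_steklov_comm {f g : SpaceTime d → E} (hf : Continuous f)
    (hfc : HasCompactSupport f) (hg : Continuous g) (hgc : HasCompactSupport g) (h : ℝ) :
    ∫ p, inner ℝ (g p) (steklov h f p) = ∫ p, inner ℝ (f p) (steklov (-h) g p) := by
  rw [integral_inner_steklov hf hg hgc, integral_inner_steklov hg hf hfc]
  congr 1 with σ
  -- Translating by `h * σ` in time trades the backward shift of `f` for a forward shift of `g`.
  rw [← integral_sub_right_eq_self (fun p => inner ℝ (f p) (g (p - (0, -h * σ))))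
    ((0 : Space d), h * σ)]
  congr 1 with p
  rw [real_inner_comm, sub_sub, Prod.mk_add_mk, add_zero, neg_mul, add_neg_cancel,
    show ((0 : Space d), (0 : ℝ)) = 0 from rfl, sub_zero]

/-- Write `‖A f‖² = ∫ (A f, τ_σ f) dσ` for the average `A f` and the translates `τ_σ f`.
Translations preserve the `L²` norm, so this is at most `½ ‖A f‖² + ½ ‖f‖²`, and the first term is
absorbed. -/
theorem integral_norm_steklov_sq_le {f : SpaceTime d → E} (hf : Continuous f)
    (hfc : HasCompactSupport f) (h : ℝ) :
    ∫ p, ‖steklov h f p‖ ^ 2 ≤ ∫ p, ‖f p‖ ^ 2 := by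
  have hG := continuous_steklov hf h
  have hGc := hasCompactSupport_steklov hfc h
  have hi := integrable_norm_sq hf hfc
  have hiG := integrable_norm_sq hG hGc
  have h1 : ∫ p, ‖steklov h f p‖ ^ 2 =
      ∫ σ in (0 : ℝ)..1, ∫ p, inner ℝ (steklov h f p) (f (p - (0, h * σ))) := by
    rw [← integral_inner_steklov hf hG hGc]
    simp only [real_inner_self_eq_norm_sq]
  have h2 : ∀ σ : ℝ, ‖∫ p, inner ℝ (steklov h f p) (f (p - (0, h * σ)))‖ ≤
      1 / 2 * (∫ p, ‖steklov h f p‖ ^ 2) + 1 / 2 * ∫ p, ‖f p‖ ^ 2 := by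
    intro σ
    have hi' : Integrable fun p : SpaceTime d => ‖f (p - (0, h * σ))‖ ^ 2 := hi.comp_sub_right _
    rw [← integral_sub_right_eq_self (fun p => ‖f p‖ ^ 2) ((0 : Space d), h * σ),
      ← integral_const_mul, ← integral_const_mul,
      ← integral_add (hiG.const_mul _) (hi'.const_mul _)]
    refine norm_integral_le_of_norm_le ((hiG.const_mul _).add (hi'.const_mul _))
      (Eventually.of_forall fun p => ?_)
    refine (norm_inner_le_norm _ _).trans ?_
    nlinarith [sq_nonneg (‖steklov h f p‖ - ‖f (p - (0, h * σ))‖)]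
  have h3 := intervalIntegral.norm_integral_le_of_norm_le_const (a := 0) (b := 1)
    fun σ _ => h2 σ
  rw [← h1, Real.norm_eq_abs, abs_of_nonneg (integral_nonneg fun _ => by positivity)] at h3
  simp only [sub_zero, abs_one, mul_one] at h3
  linarith

end InnerProduct

end Steklov

namespace MovingDomain

variable {d : ℕ} {D : MovingDomain d}

/-! ### Averages of test functions -/

/-- The Steklov average of a test function. -/
def average (h : ℝ) : D.Test →ₗ[ℝ] D.Test where
  toFun φ := mkTest (steklov h φ) (contDiff_steklov (contDiff_test φ) φ.hasCompactSupport h)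
    (hasCompactSupport_steklov φ.hasCompactSupport h) (by
      intro p hp
      -- Averaging moves points of the support in time only, so their spatial part stays in `Ω`.
      obtain ⟨q, hq, rfl⟩ := tsupport_steklov_subset φ.hasCompactSupport h hp
      simpa using fst_mem_of_mem_tsupport φ hq.1)
  map_add' φ ψ := by
    ext p
    exact intervalIntegral.integral_add
      (Continuous.intervalIntegrable (φ.continuous.comp (by fun_prop)) _ _)
      (Continuous.intervalIntegrable (ψ.continuous.comp (by fun_prop)) _ _)
  map_smul' c φ := by
    ext p
    exact intervalIntegral.integral_const_mul _ _

theorem spaceGrad_average (h : ℝ) (φ : D.Test) :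
    spaceGrad (average h φ) = steklov h (spaceGrad φ) :=
  spaceGrad_steklov (contDiff_test φ) φ.hasCompactSupport h

theorem tsupport_ofQ_subset (φ : 𝓓^{1}(D.Q, ℝ)) :
    tsupport (ofQ φ : SpaceTime d → ℝ) ⊆ D.Q := φ.tsupport_subset

theorem ofQ_eq_zero (φ : 𝓓^{1}(D.Q, ℝ)) {p : SpaceTime d} (hp : p ∉ D.Q) : ofQ φ p = 0 :=
  image_eq_zero_of_notMem_tsupport fun h => hp (tsupport_ofQ_subset φ h)

theorem spaceGrad_ofQ_eq_zero (φ : 𝓓^{1}(D.Q, ℝ)) {p : SpaceTime d} (hp : p ∉ D.Q) :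
    spaceGrad (ofQ φ) p = 0 :=
  spaceGrad_eq_zero_of_notMem_tsupport (contDiff_test _) fun h => hp (tsupport_ofQ_subset φ h)

theorem integral_Q_of_eq_zero {F : SpaceTime d → ℝ} (hF : ∀ p, p ∉ D.Q → F p = 0) :
    ∫ p in (D.Q : Set (SpaceTime d)), F p = ∫ p, F p :=
  setIntegral_eq_integral_of_forall_compl_eq_zero hF

section Averages

variable {E : Type*} [NormedAddCommGroup E] [InnerProductSpace ℝ E] [CompleteSpace E]
  {f g : SpaceTime d → E}

/-- Since `f` vanishes outside `Q_T`, its norm there is its full norm; restricting the average to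
`Q_T` only loses mass. -/
theorem norm_toLp_steklov_le (hf : Continuous f) (hfc : HasCompactSupport f)
    (hfQ : ∀ p, p ∉ D.Q → f p = 0) (h : ℝ)
    (h1 : MemLp (steklov h f) 2 (volume.restrict (D.Q : Set (SpaceTime d))))
    (h2 : MemLp f 2 (volume.restrict (D.Q : Set (SpaceTime d)))) :
    ‖h1.toLp _‖ ^ 2 ≤ ‖h2.toLp _‖ ^ 2 := by
  have e := integral_Q_of_eq_zero (D := D) (F := fun p => ‖f p‖ ^ 2) fun p hp => by
    simp [hfQ p hp]
  rw [norm_toLp_sq, norm_toLp_sq, e]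
  refine le_trans (setIntegral_le_integral (integrable_norm_sq (continuous_steklov hf h)
    (hasCompactSupport_steklov hfc h)) (Eventually.of_forall fun p => sq_nonneg _)) ?_
  exact integral_norm_steklov_sq_le hf hfc h

theorem inner_toLp_steklov (hf : Continuous f) (hfc : HasCompactSupport f)
    (hfQ : ∀ p, p ∉ D.Q → f p = 0) (hg : Continuous g) (hgc : HasCompactSupport g)
    (hgQ : ∀ p, p ∉ D.Q → g p = 0) (h : ℝ)
    (h1 : MemLp (steklov h f) 2 (volume.restrict (D.Q : Set (SpaceTime d))))
    (h2 : MemLp f 2 (volume.restrict (D.Q : Set (SpaceTime d))))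
    (h3 : MemLp (steklov (-h) g) 2 (volume.restrict (D.Q : Set (SpaceTime d))))
    (h4 : MemLp g 2 (volume.restrict (D.Q : Set (SpaceTime d)))) :
    inner ℝ (h1.toLp _) (h4.toLp _) = inner ℝ (h2.toLp _) (h3.toLp _) := by
  rw [real_inner_comm, inner_toLp, inner_toLp,
    integral_Q_of_eq_zero fun p hp => by simp [hgQ p hp],
    integral_Q_of_eq_zero fun p hp => by simp [hfQ p hp],
    integral_inner_steklov_comm hf hfc hg hgc]

theorem tendsto_toLp_steklov (hf : Continuous f) (hfc : HasCompactSupport f) {s : ℕ → ℝ}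
    (hs : Tendsto s atTop (𝓝 0))
    (h1 : ∀ n, MemLp (steklov (s n) f) 2 (volume.restrict (D.Q : Set (SpaceTime d))))
    (h2 : MemLp f 2 (volume.restrict (D.Q : Set (SpaceTime d)))) :
    Tendsto (fun n => (h1 n).toLp _) atTop (𝓝 (h2.toLp _)) := by
  have := D.isFiniteMeasure_Q
  obtain ⟨C, hC0, hC⟩ := exists_norm_le hf hfc
  refine tendsto_toLp_of_bounded h1 h2 (C + C) (fun n => Eventually.of_forall fun p => ?_)
    (Eventually.of_forall fun p => ?_)
  · refine (norm_sub_le _ _).trans (add_le_add ?_ (hC p))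
    have := intervalIntegral.norm_integral_le_of_norm_le_const (a := 0) (b := 1)
      (f := fun σ : ℝ => f (p - (0, s n * σ))) fun σ _ => hC _
    rwa [sub_zero, abs_one, mul_one] at this
  · rw [Metric.tendsto_atTop']
    intro ε hε
    obtain ⟨δ, hδ, h⟩ := exists_steklov_sub_le hf hfc (half_pos hε)
    obtain ⟨N, hN⟩ := Metric.tendsto_atTop'.1 hs δ hδ
    refine ⟨N, fun n hn => ?_⟩
    rw [dist_eq_norm]
    refine (h (s n) ?_ p).trans_lt (half_lt_self hε)
    simpa using hN n hn

end Averages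

theorem gradL2_average (h : ℝ) (φ : D.Test)
    (hm : MemLp (steklov h (spaceGrad φ)) 2 (volume.restrict (D.Q : Set (SpaceTime d)))) :
    gradL2 (average h φ) = hm.toLp _ :=
  MemLp.toLp_congr (memLp_spaceGrad (average h φ)) hm (.of_eq (spaceGrad_average h φ))

theorem memLp_steklov_spaceGrad (h : ℝ) (φ : D.Test) :
    MemLp (steklov h (spaceGrad φ)) 2 (volume.restrict (D.Q : Set (SpaceTime d))) :=
  (spaceGrad_average h φ) ▸ memLp_spaceGrad (average h φ)

theorem norm_toY_average_le (h : ℝ) (φ : 𝓓^{1}(D.Q, ℝ)) :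
    ‖toY (average h (ofQ φ))‖ ≤ ‖toY (ofQ φ)‖ := by
  refine le_of_sq_le_sq ?_ (norm_nonneg _)
  rw [norm_sq_Y, norm_sq_Y]
  refine add_le_add (norm_toLp_steklov_le (ofQ φ).continuous (ofQ φ).hasCompactSupport
    (fun p => ofQ_eq_zero φ) h (memLp_fn (average h (ofQ φ))) (memLp_fn (ofQ φ))) ?_
  rw [grad_toY, gradL2_average _ _ (memLp_steklov_spaceGrad _ _)]
  exact norm_toLp_steklov_le (continuous_spaceGrad (contDiff_test (ofQ φ)))
    (hasCompactSupport_spaceGrad (contDiff_test (ofQ φ)) (ofQ φ).hasCompactSupport)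
    (fun p => spaceGrad_ofQ_eq_zero φ) h _ (memLp_spaceGrad (ofQ φ))

theorem inner_Y (u v : D.Y) :
    inner ℝ u v = inner ℝ (D.toFn u) (D.toFn v) + inner ℝ (D.grad u) (D.grad v) :=
  WithLp.prod_inner_apply (u : D.Pair) (v : D.Pair)

theorem inner_toY_average (h : ℝ) (φ ψ : 𝓓^{1}(D.Q, ℝ)) :
    inner ℝ (toY (average h (ofQ φ))) (toY (ofQ ψ)) =
      inner ℝ (toY (ofQ φ)) (toY (average (-h) (ofQ ψ))) := by
  rw [inner_Y, inner_Y]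
  congr 1
  · exact inner_toLp_steklov (ofQ φ).continuous (ofQ φ).hasCompactSupport
      (fun p => ofQ_eq_zero φ) (ofQ ψ).continuous (ofQ ψ).hasCompactSupport
      (fun p => ofQ_eq_zero ψ) h (memLp_fn (average h (ofQ φ))) (memLp_fn (ofQ φ))
      (memLp_fn (average (-h) (ofQ ψ))) (memLp_fn (ofQ ψ))
  · simp only [grad_toY]
    rw [gradL2_average _ _ (memLp_steklov_spaceGrad _ _),
      gradL2_average _ _ (memLp_steklov_spaceGrad _ _)]
    exact inner_toLp_steklov (continuous_spaceGrad (contDiff_test (ofQ φ)))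
      (hasCompactSupport_spaceGrad (contDiff_test (ofQ φ)) (ofQ φ).hasCompactSupport)
      (fun p => spaceGrad_ofQ_eq_zero φ) (continuous_spaceGrad (contDiff_test (ofQ ψ)))
      (hasCompactSupport_spaceGrad (contDiff_test (ofQ ψ)) (ofQ ψ).hasCompactSupport)
      (fun p => spaceGrad_ofQ_eq_zero ψ) h _ (memLp_spaceGrad (ofQ φ)) _ (memLp_spaceGrad (ofQ ψ))

theorem tendsto_toY {φ : ℕ → D.Test} {u : D.Y}
    (h1 : Tendsto (fun n => fnL2 (φ n)) atTop (𝓝 (D.toFn u)))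
    (h2 : Tendsto (fun n => gradL2 (φ n)) atTop (𝓝 (D.grad u))) :
    Tendsto (fun n => toY (φ n)) atTop (𝓝 u) :=
  tendsto_subtype_rng.2
    (((WithLp.prod_continuous_toLp 2 _ _).tendsto _).comp (h1.prodMk_nhds h2))

theorem tendsto_toY_average (φ : D.Test) {s : ℕ → ℝ} (hs : Tendsto s atTop (𝓝 0)) :
    Tendsto (fun n => toY (average (s n) φ)) atTop (𝓝 (toY φ)) := by
  refine tendsto_toY ?_ ?_
  · exact tendsto_toLp_steklov φ.continuous φ.hasCompactSupport hs
      (fun n => memLp_fn (average (s n) φ)) (memLp_fn φ)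
  · simp only [fun n => gradL2_average (s n) φ (memLp_steklov_spaceGrad _ _)]
    exact tendsto_toLp_steklov (continuous_spaceGrad (contDiff_test φ))
      (hasCompactSupport_spaceGrad (contDiff_test φ) φ.hasCompactSupport) hs _ (memLp_spaceGrad φ)

theorem timeDiff_average {h : ℝ} (hh : h ≠ 0) (φ : D.Test) (p : SpaceTime d) :
    timeDiff (average h φ) p = h⁻¹ * (φ p - φ (p - (0, h))) :=
  timeDiff_steklov (contDiff_test φ) φ.hasCompactSupport hh p

/-- Discrete integration by parts: a translation moves the difference quotient to the other factor
with opposite sign. There are no boundary terms, because on each side the factor that is not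
averaged vanishes outside `Q_T`. -/
theorem inner_dtL2_average {h : ℝ} (hh : h ≠ 0) (φ ψ : 𝓓^{1}(D.Q, ℝ)) :
    inner ℝ (dtL2 (average h (ofQ φ))) (fnL2 (ofQ ψ)) =
      -inner ℝ (fnL2 (ofQ φ)) (dtL2 (average (-h) (ofQ ψ))) := by
  have e1 : inner ℝ (dtL2 (average h (ofQ φ))) (fnL2 (ofQ ψ)) =
      ∫ p, timeDiff (average h (ofQ φ)) p * ofQ ψ p := by
    refine (inner_toLp (memLp_timeDiff _) (memLp_fn _)).trans ?_
    rw [← integral_Q_of_eq_zero fun p hp => by rw [ofQ_eq_zero ψ hp, mul_zero]]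
    congr 1 with p
    exact mul_comm _ _
  have e2 : inner ℝ (fnL2 (ofQ φ)) (dtL2 (average (-h) (ofQ ψ))) =
      ∫ p, ofQ φ p * timeDiff (average (-h) (ofQ ψ)) p := by
    refine (inner_toLp (memLp_fn _) (memLp_timeDiff _)).trans ?_
    rw [← integral_Q_of_eq_zero fun p hp => by rw [ofQ_eq_zero φ hp, zero_mul]]
    congr 1 with p
    exact mul_comm _ _
  rw [e1, e2]
  simp only [timeDiff_average hh, timeDiff_average (neg_ne_zero.2 hh)]
  have hcφ := (ofQ φ).continuous
  have hcψ := (ofQ ψ).continuous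
  have i0 : Integrable fun p => ofQ φ p * ofQ ψ p :=
    (hcφ.mul hcψ).integrable_of_hasCompactSupport (ofQ φ).hasCompactSupport.mul_right
  have i1 : Integrable fun p : SpaceTime d => ofQ φ (p - (0, h)) * ofQ ψ p :=
    ((hcφ.comp (by fun_prop)).mul hcψ).integrable_of_hasCompactSupport
      (ofQ ψ).hasCompactSupport.mul_left
  have i2 : Integrable fun p : SpaceTime d => ofQ φ p * ofQ ψ (p - (0, -h)) :=
    (hcφ.mul (hcψ.comp (by fun_prop))).integrable_of_hasCompactSupport
      (ofQ φ).hasCompactSupport.mul_right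
  have e3 : ∫ p : SpaceTime d, ofQ φ (p - (0, h)) * ofQ ψ p =
      ∫ p : SpaceTime d, ofQ φ p * ofQ ψ (p - (0, -h)) := by
    rw [← integral_sub_right_eq_self (fun p : SpaceTime d => ofQ φ p * ofQ ψ (p - (0, -h)))
      ((0 : Space d), h)]
    congr 1 with p
    rw [sub_sub, Prod.mk_add_mk, add_zero, add_neg_cancel,
      show ((0 : Space d), (0 : ℝ)) = 0 from rfl, sub_zero]
  have e4 : ∀ p : SpaceTime d, h⁻¹ * (ofQ φ p - ofQ φ (p - (0, h))) * ofQ ψ p =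
      h⁻¹ * (ofQ φ p * ofQ ψ p - ofQ φ (p - (0, h)) * ofQ ψ p) := fun p => by ring
  have e5 : ∀ p : SpaceTime d, ofQ φ p * ((-h)⁻¹ * (ofQ ψ p - ofQ ψ (p - (0, -h)))) =
      -h⁻¹ * (ofQ φ p * ofQ ψ p - ofQ φ p * ofQ ψ (p - (0, -h))) := fun p => by
    rw [inv_neg]; ring
  simp only [e4, e5]
  rw [integral_const_mul, integral_const_mul, integral_sub i0 i1, integral_sub i0 i2, e3]
  ring

/-- The price of averaging is a factor `1 / |h|`, so in `exists_test` the width `h` is fixed before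
the approximating test function is chosen. -/
theorem norm_dtL2_average_le {h : ℝ} (hh : h ≠ 0) (φ : 𝓓^{1}(D.Q, ℝ)) :
    ‖dtL2 (average h (ofQ φ))‖ ≤ 2 * |h|⁻¹ * ‖fnL2 (ofQ φ)‖ := by
  have hc := (ofQ φ).continuous
  have hshift : Continuous fun p : SpaceTime d => ofQ φ (p - (0, h)) := hc.comp (by fun_prop)
  have hmem : MemLp (fun p : SpaceTime d => ofQ φ (p - (0, h))) 2
      (volume.restrict (D.Q : Set (SpaceTime d))) :=
    memLp_of_hasCompactSupport hshift
      ((ofQ φ).hasCompactSupport.comp_homeomorph (Homeomorph.subRight ((0 : Space d), h)))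
  have e : dtL2 (average h (ofQ φ)) = h⁻¹ • (fnL2 (ofQ φ) - hmem.toLp _) := by
    refine Eq.trans ?_ (congrArg _ (MemLp.toLp_sub (memLp_fn (ofQ φ)) hmem))
    rw [← MemLp.toLp_const_smul]
    exact MemLp.toLp_congr (memLp_timeDiff _) _ (.of_eq (funext (timeDiff_average hh (ofQ φ))))
  have hle : ‖hmem.toLp _‖ ≤ ‖fnL2 (ofQ φ)‖ := by
    refine le_of_sq_le_sq ?_ (norm_nonneg _)
    refine le_of_le_of_eq ?_ (norm_toLp_sq (memLp_fn (ofQ φ))).symm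
    have e := integral_Q_of_eq_zero (D := D) (F := fun p => ‖ofQ φ p‖ ^ 2) fun p hp => by
      rw [ofQ_eq_zero φ hp]; simp
    rw [norm_toLp_sq, e, ← integral_sub_right_eq_self (fun p => ‖ofQ φ p‖ ^ 2) ((0 : Space d), h)]
    exact setIntegral_le_integral
      ((integrable_norm_sq hc (ofQ φ).hasCompactSupport).comp_sub_right _)
      (Eventually.of_forall fun p => sq_nonneg _)
  rw [e, norm_smul, norm_inv, Real.norm_eq_abs, mul_comm (2 : ℝ), mul_assoc]
  refine mul_le_mul_of_nonneg_left ?_ (by positivity)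
  exact (norm_sub_le _ _).trans (by linarith)

/-! ### Averages on `Y` -/

variable (D) in
/-- The Steklov average as an operator on `Y`. -/
def averageY (h : ℝ) : D.Y →L[ℝ] D.Y :=
  (toY ∘ₗ average h ∘ₗ ofQ : 𝓓^{1}(D.Q, ℝ) →ₗ[ℝ] D.Y).extendOfNorm
    (toY ∘ₗ ofQ : 𝓓^{1}(D.Q, ℝ) →ₗ[ℝ] D.Y)

theorem averageY_toY (h : ℝ) (φ : 𝓓^{1}(D.Q, ℝ)) :
    D.averageY h (toY (ofQ φ)) = toY (average h (ofQ φ)) :=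
  LinearMap.extendOfNorm_eq D.denseRange_toY_ofQ
    ⟨1, fun φ => (norm_toY_average_le h φ).trans (one_mul _).ge⟩ φ

theorem norm_averageY_le (h : ℝ) (u : D.Y) : ‖D.averageY h u‖ ≤ ‖u‖ := by
  revert u
  refine le_of_forall_test (by fun_prop) (by fun_prop) fun φ => ?_
  rw [averageY_toY]
  exact norm_toY_average_le h φ

/-- The adjoint is taken in `Y`, not merely in `L²`: averaging in time commutes with the spatial
gradient. -/
theorem inner_averageY (h : ℝ) (u v : D.Y) :
    inner ℝ (D.averageY h u) v = inner ℝ u (D.averageY (-h) v) := by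
  revert u
  refine eq_of_forall_test (by fun_prop) (by fun_prop) fun φ => ?_
  revert v
  refine eq_of_forall_test (by fun_prop) (by fun_prop) fun ψ => ?_
  rw [averageY_toY, averageY_toY]
  exact inner_toY_average h φ ψ

/-- Convergence on the dense set of test functions extends to `Y` because the averages are
contractions. -/
theorem tendsto_averageY (u : D.Y) {s : ℕ → ℝ} (hs : Tendsto s atTop (𝓝 0)) :
    Tendsto (fun n => D.averageY (s n) u) atTop (𝓝 u) := by
  rw [Metric.tendsto_atTop]
  intro ε hε
  obtain ⟨φ, hφ⟩ := Metric.denseRange_iff.1 D.denseRange_toY_ofQ u (ε / 3) (by positivity)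
  obtain ⟨N, hN⟩ := Metric.tendsto_atTop.1 (tendsto_toY_average (ofQ φ) hs) (ε / 3) (by positivity)
  refine ⟨N, fun n hn => ?_⟩
  have h1 := hN n hn
  rw [← averageY_toY] at h1
  have h2 : dist (D.averageY (s n) u) (D.averageY (s n) (toY (ofQ φ))) < ε / 3 := by
    rw [dist_eq_norm, ← map_sub]
    refine (norm_averageY_le _ _).trans_lt ?_
    rwa [← dist_eq_norm]
  have h3 : dist u (toY (ofQ φ)) < ε / 3 := hφ
  calc _ ≤ dist (D.averageY (s n) u) (D.averageY (s n) (toY (ofQ φ))) +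
        dist (D.averageY (s n) (toY (ofQ φ))) (toY (ofQ φ)) + dist (toY (ofQ φ)) u :=
        dist_triangle4 _ _ _ _
    _ < ε := by
      rw [dist_comm (toY (ofQ φ)) u]
      linarith

/-! ### Time derivatives with vanishing initial value -/

/-- The functional `ξ ∈ Y'` is the time derivative of `u`, also when tested with functions that do
not vanish at time `0`. This means that `∂ₜu = ξ` and that `u` vanishes at time `0`. -/
def HasTimeDerivFromZero (u : D.Y) (ξ : StrongDual ℝ D.Y) : Prop :=
  ∀ φ : D.Test, (∀ p ∈ tsupport (φ : SpaceTime d → ℝ), p.2 < D.T) →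
    ξ (toY φ) = -inner ℝ (D.toFn u) (dtL2 φ)

theorem neg_integral_timeDiff (u : D.Y) (φ : 𝓓^{1}(D.Q, ℝ)) :
    -∫ p in (D.Q : Set (SpaceTime d)), D.toFn u p * timeDiff (φ : SpaceTime d → ℝ) p =
      -inner ℝ (D.toFn u) (dtL2 (ofQ φ)) := by
  congr 1
  refine Eq.trans ?_ (inner_toLp_right (D.toFn u) (memLp_timeDiff (ofQ φ))).symm
  congr 1 with p
  exact mul_comm _ _

theorem HasTimeDerivFromZero.hasTimeDeriv {u : D.Y} {ξ : StrongDual ℝ D.Y}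
    (h : HasTimeDerivFromZero u ξ) : D.HasTimeDeriv u ξ := by
  intro φ
  rw [testY_eq, neg_integral_timeDiff]
  exact h (ofQ φ) fun p hp => (tsupport_ofQ_subset φ hp).2.2

/-- For `h > 0` the average looks into the past, where at times `t ≤ 0` the function is zero. -/
theorem average_eq_zero {h : ℝ} (hh : 0 < h) (φ : 𝓓^{1}(D.Q, ℝ)) {p : SpaceTime d}
    (hp : p.2 ≤ 0) : average h (ofQ φ) p = 0 := by
  refine (intervalIntegral.integral_congr (g := fun _ => (0 : ℝ)) fun σ hσ => ?_).trans (by simp)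
  rw [uIcc_of_le zero_le_one] at hσ
  refine ofQ_eq_zero φ fun hq => ?_
  have h1 : 0 < p.2 - h * σ := hq.2.1
  nlinarith [mul_nonneg hh.le hσ.1]

/-- The average over `[t, t + h]` moves the support towards the past: it stays before `T` but may
cross time `0`. These are exactly the tests that `HasTimeDerivFromZero` allows. -/
theorem snd_lt_of_mem_tsupport_average {h : ℝ} (hh : 0 < h) (φ : 𝓓^{1}(D.Q, ℝ)) {p : SpaceTime d}
    (hp : p ∈ tsupport (average (-h) (ofQ φ) : SpaceTime d → ℝ)) : p.2 < D.T := by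
  obtain ⟨q, hq, rfl⟩ := tsupport_steklov_subset (ofQ φ).hasCompactSupport (-h) hp
  have h1 : q.1.2 < D.T := (tsupport_ofQ_subset φ hq.1).2.2
  have h2 : q.1.2 + -h * q.2 < D.T := by nlinarith [mul_nonneg hh.le hq.2.1]
  exact h2

/-- A function `u ∈ Y` with `∂ₜu = ξ` and vanishing initial value is the limit of test functions
with vanishing initial value, together with the time derivative. -/
theorem HasTimeDerivFromZero.exists_test {u : D.Y} {ξ : StrongDual ℝ D.Y}
    (hu : HasTimeDerivFromZero u ξ) {ε : ℝ} (hε : 0 < ε) :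
    ∃ φ : D.Test, (∀ p : SpaceTime d, p.2 ≤ 0 → φ p = 0) ∧ ‖toY φ - u‖ ≤ ε ∧
      ∀ ψ : D.Y, |inner ℝ (dtL2 φ) (D.toFn ψ) - ξ ψ| ≤ ε * ‖ψ‖ := by
  -- The Riesz representative turns the convergence of `ξ ∘ averageY (-h)` to `ξ` in `Y'` into the
  -- convergence of `averageY h z` to `z` in `Y`.
  set z : D.Y := (InnerProductSpace.toDual ℝ D.Y).symm ξ with hz
  have hξ : ∀ y, ξ y = inner ℝ z y := fun y => (InnerProductSpace.toDual_symm_apply).symm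
  have hs : Tendsto (fun n : ℕ => 1 / ((n : ℝ) + 1)) atTop (𝓝 0) :=
    tendsto_one_div_add_atTop_nhds_zero_nat
  obtain ⟨n, hn1, hn2⟩ := ((Metric.tendsto_nhds.1 (tendsto_averageY u hs) (ε / 2) (half_pos hε)).and
    (Metric.tendsto_nhds.1 (tendsto_averageY z hs) (ε / 2) (half_pos hε))).exists
  set h : ℝ := 1 / ((n : ℝ) + 1) with hh
  have hpos : 0 < h := by positivity
  -- The time derivative of an average costs a factor `2 / h`, so an error `ε * h / 4` in `u`
  -- becomes `ε / 2` in `Y'`.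
  obtain ⟨φ, hφ⟩ := Metric.denseRange_iff.1 D.denseRange_toY_ofQ u (min (ε / 2) (ε * h / 4))
    (by positivity)
  have hφ1 : ‖toY (ofQ φ) - u‖ ≤ min (ε / 2) (ε * h / 4) := by
    rw [← dist_eq_norm, dist_comm]
    exact hφ.le
  refine ⟨average h (ofQ φ), fun p hp => average_eq_zero hpos φ hp, ?_, ?_⟩
  · rw [← averageY_toY]
    have h1 : D.averageY h (toY (ofQ φ)) - u =
        D.averageY h (toY (ofQ φ) - u) + (D.averageY h u - u) := by
      rw [map_sub]; abel
    rw [h1]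
    have h2 := norm_averageY_le h (toY (ofQ φ) - u)
    have h3 := hφ1.trans (min_le_left _ _)
    rw [dist_eq_norm] at hn1
    exact (norm_add_le _ _).trans (by linarith)
  · have hcont : Continuous D.toFn := D.fnCLM.continuous
    refine le_of_forall_test (by fun_prop) (by fun_prop) fun ψ => ?_
    -- The derivative is moved onto the forward average of `ψ`, an admissible test in `hu`; only the
    -- error `φ - u` remains.
    have e1 : inner ℝ (dtL2 (average h (ofQ φ))) (D.toFn (toY (ofQ ψ))) -
          ξ (toY (average (-h) (ofQ ψ))) =
        -inner ℝ (D.toFn (toY (ofQ φ) - u)) (dtL2 (average (-h) (ofQ ψ))) := by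
      have h1 : D.toFn (toY (ofQ φ) - u) = fnL2 (ofQ φ) - D.toFn u := D.fnCLM.map_sub _ _
      rw [hu _ fun p hp => snd_lt_of_mem_tsupport_average hpos ψ hp, toFn_toY,
        inner_dtL2_average hpos.ne', h1, inner_sub_left]
      ring
    have e2 : ξ (toY (average (-h) (ofQ ψ))) - ξ (toY (ofQ ψ)) =
        inner ℝ (D.averageY h z - z) (toY (ofQ ψ)) := by
      rw [hξ, hξ, ← averageY_toY, inner_sub_left, inner_averageY]
    have n1 : ‖D.toFn (toY (ofQ φ) - u)‖ ≤ ε * h / 4 := by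
      refine le_trans ?_ (hφ1.trans (min_le_right _ _))
      refine le_of_sq_le_sq ?_ (norm_nonneg _)
      rw [norm_sq_Y]
      nlinarith [sq_nonneg ‖D.grad (toY (ofQ φ) - u)‖]
    have n2 : ‖dtL2 (average (-h) (ofQ ψ))‖ ≤ 2 * h⁻¹ * ‖toY (ofQ ψ)‖ := by
      have := norm_dtL2_average_le (neg_ne_zero.2 hpos.ne') ψ
      rw [abs_neg, abs_of_pos hpos] at this
      refine this.trans (mul_le_mul_of_nonneg_left ?_ (by positivity))
      refine le_of_sq_le_sq ?_ (norm_nonneg _)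
      rw [norm_sq_Y, toFn_toY]
      nlinarith [sq_nonneg ‖D.grad (toY (ofQ ψ))‖]
    have b1 : |inner ℝ (dtL2 (average h (ofQ φ))) (D.toFn (toY (ofQ ψ))) -
        ξ (toY (average (-h) (ofQ ψ)))| ≤ ε / 2 * ‖toY (ofQ ψ)‖ := by
      rw [e1, abs_neg]
      refine (abs_real_inner_le_norm _ _).trans
        ((mul_le_mul n1 n2 (norm_nonneg _) (by positivity)).trans (le_of_eq ?_))
      field_simp
      ring
    have b2 : |ξ (toY (average (-h) (ofQ ψ))) - ξ (toY (ofQ ψ))| ≤ ε / 2 * ‖toY (ofQ ψ)‖ := by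
      rw [e2]
      refine (abs_real_inner_le_norm _ _).trans ?_
      rw [dist_eq_norm] at hn2
      gcongr
    calc _ ≤ _ := abs_sub_le _ (ξ (toY (average (-h) (ofQ ψ)))) _
      _ ≤ ε * ‖toY (ofQ ψ)‖ := by linarith

/-! ### The energy identity for test functions -/

theorem norm_toFn_le (u : D.Y) : ‖D.toFn u‖ ≤ ‖u‖ := by
  refine le_of_sq_le_sq ?_ (norm_nonneg _)
  rw [norm_sq_Y]
  nlinarith [sq_nonneg ‖D.grad u‖]

/-- The end time `s` is free: `s = D.T` gives the signs of `(∂ₜφ, φ)`, other values the bound on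
time slices. -/
theorem integral_timeDiff_mul_self (φ : D.Test) {s : ℝ} (hs : 0 ≤ s) :
    2 * ∫ p in (D.Ω : Set (Space d)) ×ˢ Ioo 0 s, timeDiff φ p * φ p =
      (∫ x in (D.Ω : Set (Space d)), φ (x, s) ^ 2) -
        ∫ x in (D.Ω : Set (Space d)), φ (x, 0) ^ 2 := by
  have hcd := continuous_timeDiff (contDiff_test φ)
  have hint : Integrable fun p => timeDiff φ p * φ p :=
    (hcd.mul φ.continuous).integrable_of_hasCompactSupport φ.hasCompactSupport.mul_left
  have hsq : ∀ t : ℝ, Integrable fun x => φ (x, t) ^ 2 := fun t =>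
    ((φ.continuous.comp (by fun_prop)).pow 2).integrable_of_hasCompactSupport
      ((hasCompactSupport_slice φ t).mono fun x hx h => hx (by simp [h]))
  rw [Measure.volume_eq_prod, setIntegral_prod _ hint.integrableOn, ← integral_const_mul,
    ← integral_sub (hsq s).integrableOn (hsq 0).integrableOn]
  congr 1 with x
  have hder : ∀ t ∈ uIcc 0 s, HasDerivAt (fun t => φ (x, t) ^ 2)
      (2 * (timeDiff φ (x, t) * φ (x, t))) t := fun t _ => by
    have h := (hasDerivAt_timeDiff (contDiff_test φ) x t).pow 2
    refine h.congr_deriv ?_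
    simp
    ring
  rw [← intervalIntegral.integral_eq_sub_of_hasDerivAt hder
    (Continuous.intervalIntegrable (by
      have h1 : Continuous fun t : ℝ => timeDiff φ (x, t) := hcd.comp (by fun_prop)
      have h2 : Continuous fun t : ℝ => φ (x, t) := φ.continuous.comp (by fun_prop)
      fun_prop) _ _), intervalIntegral.integral_const_mul, intervalIntegral.integral_of_le hs,
    integral_Ioc_eq_integral_Ioo]

theorem inner_dtL2_fnL2 (φ ψ : D.Test) :
    inner ℝ (dtL2 φ) (fnL2 ψ) = ∫ p in (D.Q : Set (SpaceTime d)), timeDiff φ p * ψ p := by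
  refine (inner_toLp (memLp_timeDiff φ) (memLp_fn ψ)).trans ?_
  congr 1 with p
  exact mul_comm _ _

theorem two_mul_inner_dtL2_self (φ : D.Test) : 2 * inner ℝ (dtL2 φ) (fnL2 φ) =
    (∫ x in (D.Ω : Set (Space d)), φ (x, D.T) ^ 2) -
      ∫ x in (D.Ω : Set (Space d)), φ (x, 0) ^ 2 := by
  rw [inner_dtL2_fnL2, ← integral_timeDiff_mul_self φ D.T_pos.le]
  rfl

theorem inner_dtL2_self_nonneg {φ : D.Test} (h0 : ∀ p : SpaceTime d, p.2 ≤ 0 → φ p = 0) :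
    0 ≤ inner ℝ (dtL2 φ) (fnL2 φ) := by
  have h := two_mul_inner_dtL2_self φ
  simp only [h0 (_, 0) le_rfl] at h
  have h1 : 0 ≤ ∫ x in (D.Ω : Set (Space d)), φ (x, D.T) ^ 2 :=
    integral_nonneg fun _ => sq_nonneg _
  simp only [ne_eq, OfNat.ofNat_ne_zero, not_false_eq_true, zero_pow, integral_zero, sub_zero] at h
  linarith

/-- This sign makes the adjoint problem coercive in the existence proof; its counterpart above
serves uniqueness. -/
theorem inner_dtL2_self_nonpos {φ : D.Test}
    (hT : ∀ p ∈ tsupport (φ : SpaceTime d → ℝ), p.2 < D.T) :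
    inner ℝ (fnL2 φ) (dtL2 φ) ≤ 0 := by
  have h := two_mul_inner_dtL2_self φ
  have h2 : ∀ x, φ (x, D.T) = 0 := fun x => image_eq_zero_of_notMem_tsupport fun hx =>
    lt_irrefl _ (hT _ hx)
  simp only [h2] at h
  have h1 : 0 ≤ ∫ x in (D.Ω : Set (Space d)), φ (x, 0) ^ 2 :=
    integral_nonneg fun _ => sq_nonneg _
  simp only [ne_eq, OfNat.ofNat_ne_zero, not_false_eq_true, zero_pow, integral_zero, zero_sub] at h
  rw [real_inner_comm]
  linarith

/-- The time derivative is monotone on functions with vanishing initial value. -/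
theorem HasTimeDerivFromZero.apply_self_nonneg {u : D.Y} {ξ : StrongDual ℝ D.Y}
    (hu : HasTimeDerivFromZero u ξ) : 0 ≤ ξ u := by
  -- Replacing `ξ u` by `(∂ₜφ, φ) ≥ 0` costs at most `‖ξ‖ * ε` for `u` and `ε * ‖φ‖` for `ξ`.
  have key : ∀ ε : ℝ, 0 < ε → -ξ u ≤ ε * (‖u‖ + ε + ‖ξ‖) := by
    intro ε hε
    obtain ⟨φ, h0, h1, h2⟩ := hu.exists_test hε
    have h3 := inner_dtL2_self_nonneg h0
    have h4 := (abs_le.1 (h2 (toY φ))).2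
    rw [toFn_toY] at h4
    have h5 : ξ (toY φ) - ξ u ≤ ‖ξ‖ * ε := by
      rw [← map_sub]
      refine (le_abs_self _).trans ((ξ.le_opNorm _).trans ?_)
      gcongr
    have h6 : ‖toY φ‖ ≤ ‖u‖ + ε := by
      have := norm_le_norm_add_norm_sub' (toY φ) u
      linarith
    have h7 : ε * ‖toY φ‖ ≤ ε * (‖u‖ + ε) := by gcongr
    linarith
  have hlim : Tendsto (fun ε : ℝ => ε * (‖u‖ + ε + ‖ξ‖)) (𝓝[>] 0) (𝓝 0) := by
    have h : Continuous fun ε : ℝ => ε * (‖u‖ + ε + ‖ξ‖) := by fun_prop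
    have := (h.tendsto 0).mono_left (nhdsWithin_le_nhds (s := Ioi 0))
    simpa using this
  have := ge_of_tendsto hlim (eventually_nhdsWithin_of_forall key)
  linarith

/-! ### Time slices -/

variable (D) in
theorem isFiniteMeasure_Ω :
    IsFiniteMeasure ((volume : Measure (Space d)).restrict (D.Ω : Set (Space d))) := by
  rw [isFiniteMeasure_restrict]
  exact D.bounded.measure_lt_top.ne

theorem memLp_slice (t : ℝ) (φ : D.Test) :
    MemLp (fun x => φ (x, t)) 2 (volume.restrict (D.Ω : Set (Space d))) :=
  ((contDiff_slice φ t).continuous.memLp_of_hasCompactSupport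
    (hasCompactSupport_slice φ t)).restrict _

/-- The value at time `t` of a test function, in `L²(Ω)`. -/
def slice (t : ℝ) :
    D.Test →ₗ[ℝ] Lp ℝ 2 ((volume : Measure (Space d)).restrict (D.Ω : Set (Space d))) where
  toFun φ := (memLp_slice t φ).toLp _
  map_add' _ _ := MemLp.toLp_add _ _
  map_smul' _ _ := MemLp.toLp_const_smul _ _

theorem norm_slice_sq (t : ℝ) (φ : D.Test) :
    ‖slice t φ‖ ^ 2 = ∫ x in (D.Ω : Set (Space d)), φ (x, t) ^ 2 := by
  refine (norm_toLp_sq (memLp_slice t φ)).trans ?_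
  simp only [Real.norm_eq_abs, sq_abs]

theorem continuous_slice (φ : D.Test) : Continuous fun t => slice t φ := by
  have := D.isFiniteMeasure_Ω
  obtain ⟨C, _, hC⟩ := exists_norm_le φ.continuous φ.hasCompactSupport
  rw [continuous_iff_seqContinuous]
  intro s t hs
  refine tendsto_toLp_of_bounded (fun n => memLp_slice (s n) φ) (memLp_slice t φ) (C + C)
    (fun n => Eventually.of_forall fun x => (norm_sub_le _ _).trans (add_le_add (hC _) (hC _)))
    (Eventually.of_forall fun x => ?_)
  exact (φ.continuous.tendsto (x, t)).comp (tendsto_const_nhds.prodMk_nhds hs)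

theorem exists_norm_slice_le (φ : D.Test) : ∃ C : ℝ, 0 ≤ C ∧ ∀ t, ‖slice t φ‖ ≤ C := by
  have := D.isFiniteMeasure_Ω
  obtain ⟨C, hC0, hC⟩ := exists_norm_le φ.continuous φ.hasCompactSupport
  refine ⟨_, ?_, fun t => Lp.norm_le_of_ae_bound hC0 ?_⟩
  · positivity
  · filter_upwards [(memLp_slice t φ).coeFn_toLp] with x hx
    change ‖(memLp_slice t φ).toLp _ x‖ ≤ C
    rw [hx]
    exact hC _

theorem norm_toY_mulTime_le {χ : ℝ → ℝ} (hχ : ContDiff ℝ 1 χ) (hb : ∀ t, |χ t| ≤ 1) (φ : D.Test) :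
    ‖toY (mulTime χ hχ φ)‖ ≤ ‖toY φ‖ := by
  refine le_of_sq_le_sq ?_ (norm_nonneg _)
  rw [norm_sq_Y, norm_sq_Y]
  refine add_le_add (pow_le_pow_left₀ (norm_nonneg _) ?_ 2)
    (pow_le_pow_left₀ (norm_nonneg _) ?_ 2)
  · refine Lp.norm_le_norm_of_ae_le ?_
    filter_upwards [(memLp_fn (mulTime χ hχ φ)).coeFn_toLp, (memLp_fn φ).coeFn_toLp] with p h1 h2
    refine ((congrArg norm h1).trans_le ?_).trans (congrArg norm h2).ge
    refine (norm_mul_le _ _).trans ?_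
    exact mul_le_of_le_one_left (norm_nonneg _) (hb _)
  · refine Lp.norm_le_norm_of_ae_le ?_
    filter_upwards [(memLp_spaceGrad (mulTime χ hχ φ)).coeFn_toLp,
      (memLp_spaceGrad φ).coeFn_toLp] with p h1 h2
    refine ((congrArg norm h1).trans_le ?_).trans (congrArg norm h2).ge
    rw [show spaceGrad (mulTime χ hχ φ) p = χ p.2 • spaceGrad φ p from
      spaceGrad_mul_time (contDiff_test φ) χ p, norm_smul]
    exact mul_le_of_le_one_left (norm_nonneg _) (hb _)

/-- The energy estimate for test functions with vanishing initial value. -/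
theorem norm_slice_sq_le {θ : D.Test} (h0 : ∀ p : SpaceTime d, p.2 ≤ 0 → θ p = 0) {η : ℝ}
    (hη : 0 ≤ η) (h : ∀ ψ : D.Y, |inner ℝ (dtL2 θ) (D.toFn ψ)| ≤ η * ‖ψ‖) {s : ℝ}
    (hs : s ∈ Icc 0 D.T) : ‖slice s θ‖ ^ 2 ≤ 2 * (η * ‖toY θ‖) := by
  have e := integral_timeDiff_mul_self θ hs.1
  simp only [h0 (_, 0) le_rfl, ne_eq, OfNat.ofNat_ne_zero, not_false_eq_true, zero_pow,
    integral_zero, sub_zero] at e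
  rw [norm_slice_sq, ← e]
  refine mul_le_mul_of_nonneg_left ?_ two_pos.le
  have hint : Integrable fun p => timeDiff θ p * θ p :=
    ((continuous_timeDiff (contDiff_test θ)).mul θ.continuous).integrable_of_hasCompactSupport
      θ.hasCompactSupport.mul_left
  have hsub : (D.Ω : Set (Space d)) ×ˢ Ioo 0 s ⊆ (D.Q : Set (SpaceTime d)) :=
    prod_mono_right (Ioo_subset_Ioo_right hs.2)
  have hmeas : MeasurableSet ((D.Ω : Set (Space d)) ×ˢ Ioo 0 s) :=
    D.Ω.isOpen.measurableSet.prod measurableSet_Ioo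
  -- The function `θ` truncated to `(0, s)` is not `C¹`, but it is a limit of `cutoff 0 s n · θ`,
  -- whose norms in `Y` do not exceed that of `θ`; so `h` bounds each approximating integral.
  have hlim : Tendsto (fun n => ∫ p in (D.Q : Set (SpaceTime d)),
      timeDiff θ p * (cutoff 0 s n p.2 * θ p)) atTop
      (𝓝 (∫ p in (D.Q : Set (SpaceTime d)),
        ((D.Ω : Set (Space d)) ×ˢ Ioo 0 s).indicator (fun p => timeDiff θ p * θ p) p)) := by
    refine tendsto_integral_of_dominated_convergence (fun p => |timeDiff θ p * θ p|)
      (fun n => ?_) hint.abs.integrableOn (fun n => Eventually.of_forall fun p => ?_) ?_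
    · have h1 := continuous_timeDiff (contDiff_test θ)
      have h2 := (contDiff_cutoff 0 s n).continuous
      have h3 := θ.continuous
      exact Continuous.aestronglyMeasurable (by fun_prop)
    · rw [mul_left_comm, norm_mul]
      exact mul_le_of_le_one_left (norm_nonneg _) (abs_cutoff_le _ _ _ _)
    · filter_upwards [self_mem_ae_restrict D.Q.isOpen.measurableSet] with p hp
      by_cases ht : p.2 ∈ Ioo 0 s
      · rw [indicator_of_mem (show p ∈ (D.Ω : Set (Space d)) ×ˢ Ioo 0 s from ⟨hp.1, ht⟩)]
        have := ((tendsto_cutoff ht).mul_const (θ p)).const_mul (timeDiff θ p)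
        rwa [one_mul] at this
      · rw [indicator_of_notMem fun hq => ht hq.2]
        simp [cutoff_eq_zero ht]
  rw [setIntegral_indicator hmeas, inter_eq_right.2 hsub] at hlim
  refine le_of_tendsto hlim (Eventually.of_forall fun n => ?_)
  have hψ := h (toY (mulTime _ (contDiff_cutoff 0 s n) θ))
  rw [toFn_toY, inner_dtL2_fnL2] at hψ
  refine (le_abs_self _).trans (hψ.trans (mul_le_mul_of_nonneg_left ?_ hη))
  exact norm_toY_mulTime_le _ (abs_cutoff_le 0 s n) θ

/-! ### Continuous representatives -/

theorem lintegral_Q_eq {F : SpaceTime d → ℝ≥0∞} (hF : Measurable F) :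
    ∫⁻ p in (D.Q : Set (SpaceTime d)), F p = ∫⁻ t in Ioo 0 D.T, ∫⁻ x in (D.Ω : Set (Space d)),
      F (x, t) := by
  rw [volume_restrict_Q, lintegral_prod_symm _ hF.aemeasurable]

theorem enorm_sub_fnL2_sq (u : L2 (D.Q : Set (SpaceTime d))) (φ : D.Test) :
    ‖u - fnL2 φ‖ₑ ^ (2 : ℝ) =
      ∫⁻ t in Ioo 0 D.T, eLpNorm (fun x => u (x, t) - φ (x, t)) 2
        (volume.restrict (D.Ω : Set (Space d))) ^ (2 : ℝ) := by
  have hm : Measurable fun p => u p - φ p :=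
    (Lp.stronglyMeasurable u).measurable.sub φ.continuous.measurable
  have e1 : ‖u - fnL2 φ‖ₑ = eLpNorm (fun p => u p - φ p) 2
      (volume.restrict (D.Q : Set (SpaceTime d))) := by
    rw [Lp.enorm_def]
    refine eLpNorm_congr_ae ?_
    filter_upwards [Lp.coeFn_sub u (fnL2 φ), (memLp_fn φ).coeFn_toLp] with p h1 h2
    rw [h1, Pi.sub_apply]
    exact congrArg _ h2
  have e2 : ∀ {α : Type} [MeasurableSpace α] (μ : Measure α) (f : α → ℝ),
      eLpNorm f 2 μ ^ (2 : ℝ) = ∫⁻ x, ‖f x‖ₑ ^ (2 : ℝ) ∂μ := fun μ f =>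
    eLpNorm_nnreal_pow_eq_lintegral (p := 2) two_ne_zero
  simp only [e1, e2]
  exact lintegral_Q_eq (by fun_prop)

/-- Fatou's lemma: the slice distances have liminf `0` for almost every `t`. Frequent closeness
replaces the choice of a subsequence. -/
theorem ae_frequently_eLpNorm_lt {u : L2 (D.Q : Set (SpaceTime d))} {φ : ℕ → D.Test}
    (h : Tendsto (fun n => fnL2 (φ n)) atTop (𝓝 u)) :
    ∀ᵐ t ∂(volume : Measure ℝ).restrict (Ioo 0 D.T), ∀ ε : ℝ≥0∞, 0 < ε → ∃ᶠ n in atTop,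
      eLpNorm (fun x => u (x, t) - φ n (x, t)) 2 (volume.restrict (D.Ω : Set (Space d))) < ε := by
  set G : ℕ → ℝ → ℝ≥0∞ := fun n t => eLpNorm (fun x => u (x, t) - φ n (x, t)) 2
    (volume.restrict (D.Ω : Set (Space d))) ^ (2 : ℝ) with hG
  have hGm : ∀ n, Measurable (G n) := fun n => by
    have hm : Measurable fun p => u p - φ n p :=
      (Lp.stronglyMeasurable u).measurable.sub (φ n).continuous.measurable
    have e2 : G n = fun t => ∫⁻ x in (D.Ω : Set (Space d)), ‖u (x, t) - φ n (x, t)‖ₑ ^ (2 : ℝ) :=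
      funext fun t => eLpNorm_nnreal_pow_eq_lintegral (p := 2) two_ne_zero
    rw [e2]
    exact Measurable.lintegral_prod_left (f := fun x t => ‖u (x, t) - φ n (x, t)‖ₑ ^ (2 : ℝ))
      (by unfold Function.uncurry; fun_prop)
  have h1 : Tendsto (fun n => ∫⁻ t in Ioo 0 D.T, G n t) atTop (𝓝 0) := by
    simp only [hG, ← enorm_sub_fnL2_sq]
    have h2 : Tendsto (fun n => ‖u - fnL2 (φ n)‖ₑ) atTop (𝓝 0) := by
      have := (h.const_sub u).enorm
      rwa [sub_self, enorm_zero] at this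
    have := (ENNReal.continuous_rpow_const (y := 2)).tendsto 0 |>.comp h2
    simpa [Function.comp_def] using this
  have h2 : ∫⁻ t in Ioo 0 D.T, liminf (fun n => G n t) atTop = 0 :=
    le_antisymm ((lintegral_liminf_le hGm).trans h1.liminf_eq.le) zero_le
  rw [lintegral_eq_zero_iff (.liminf hGm)] at h2
  filter_upwards [h2] with t ht ε hε
  have h3 : liminf (fun n => G n t) atTop < ε ^ (2 : ℝ) := by
    rw [ht]
    exact ENNReal.rpow_pos_of_nonneg hε two_pos.le
  refine (frequently_lt_of_liminf_lt (by isBoundedDefault) h3).mono fun n hn => ?_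
  exact (ENNReal.rpow_lt_rpow_iff two_pos).1 hn

/-- At almost every `t` some slice of `φ n` is arbitrarily close to both `u(·,t)` and `w t`, so the
two agree. -/
theorem ae_eq_of_tendsto_slice {u : L2 (D.Q : Set (SpaceTime d))} {φ : ℕ → D.Test}
    (h : Tendsto (fun n => fnL2 (φ n)) atTop (𝓝 u))
    {w : ℝ → Lp ℝ 2 ((volume : Measure (Space d)).restrict (D.Ω : Set (Space d)))}
    (hw : ∀ t ∈ Icc 0 D.T, Tendsto (fun n => slice t (φ n)) atTop (𝓝 (w t))) :
    ∀ᵐ t ∂(volume : Measure ℝ).restrict (Ioo 0 D.T),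
      (fun x => u (x, t)) =ᵐ[volume.restrict (D.Ω : Set (Space d))] w t := by
  filter_upwards [ae_frequently_eLpNorm_lt h, self_mem_ae_restrict measurableSet_Ioo] with t ht hmem
  have hwt := hw t (Ioo_subset_Icc_self hmem)
  have hum : Measurable fun x => u (x, t) :=
    (Lp.stronglyMeasurable u).measurable.comp (by fun_prop)
  have hwm := Lp.stronglyMeasurable (w t)
  have key : eLpNorm (fun x => u (x, t) - w t x) 2 (volume.restrict (D.Ω : Set (Space d))) = 0 := by
    by_contra hne
    set ε := eLpNorm (fun x => u (x, t) - w t x) 2 (volume.restrict (D.Ω : Set (Space d))) with hε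
    have hpos : 0 < ε / 2 := ENNReal.half_pos hne
    have h1 : ∀ᶠ n in atTop, ‖slice t (φ n) - w t‖ₑ < ε / 2 := by
      have := (hwt.sub_const (w t)).enorm
      rw [sub_self, enorm_zero] at this
      exact this.eventually (gt_mem_nhds hpos)
    obtain ⟨n, hn1, hn2⟩ := ((ht _ hpos).and_eventually h1).exists
    have e1 : ‖slice t (φ n) - w t‖ₑ = eLpNorm (fun x => φ n (x, t) - w t x) 2
        (volume.restrict (D.Ω : Set (Space d))) := by
      rw [Lp.enorm_def]
      refine eLpNorm_congr_ae ?_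
      filter_upwards [Lp.coeFn_sub (slice t (φ n)) (w t), (memLp_slice t (φ n)).coeFn_toLp]
        with x h1 h2
      rw [h1, Pi.sub_apply]
      exact congrArg (· - w t x) h2
    have h2 : ε ≤ eLpNorm (fun x => u (x, t) - φ n (x, t)) 2
        (volume.restrict (D.Ω : Set (Space d))) + ‖slice t (φ n) - w t‖ₑ := by
      rw [e1, hε]
      have hφm := (contDiff_slice (φ n) t).continuous.measurable
      refine le_of_eq_of_le ?_ (eLpNorm_add_le (hum.sub hφm).aestronglyMeasurable
        (hφm.sub hwm.measurable).aestronglyMeasurable (by norm_num))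
      congr 1
      funext x
      simp
    refine absurd h2 (not_le.2 ?_)
    calc _ < ε / 2 + ε / 2 := ENNReal.add_lt_add hn1 hn2
      _ = ε := ENNReal.add_halves ε
  have hm : Measurable fun x => u (x, t) - w t x := hum.sub hwm.measurable
  filter_upwards [(eLpNorm_eq_zero_iff hm.aestronglyMeasurable (by norm_num)).1 key] with x hx
  exact sub_eq_zero.1 hx

/-- A function with time derivative in `Y'` and vanishing initial value in the weak sense is
continuous with values in `L²(Ω)` and vanishes at time `0`. -/
theorem HasTimeDerivFromZero.exists_continuousOn {u : D.Y} {ξ : StrongDual ℝ D.Y}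
    (hu : HasTimeDerivFromZero u ξ) :
    ∃ w : ℝ → Lp ℝ 2 ((volume : Measure (Space d)).restrict (D.Ω : Set (Space d))),
      ContinuousOn w (Icc 0 D.T) ∧
      (∀ᵐ t ∂(volume : Measure ℝ).restrict (Ioo 0 D.T),
        (fun x => D.toFn u (x, t)) =ᵐ[volume.restrict (D.Ω : Set (Space d))] w t) ∧
      w 0 = 0 := by
  have hε : ∀ n : ℕ, (0 : ℝ) < 1 / ((n : ℝ) + 1) := fun n => by positivity
  choose φ h0 h1 h2 using fun n : ℕ => hu.exists_test (hε n)
  have hlim0 : Tendsto (fun n : ℕ => 1 / ((n : ℝ) + 1)) atTop (𝓝 0) :=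
    tendsto_one_div_add_atTop_nhds_zero_nat
  have hφ : Tendsto (fun n => toY (φ n)) atTop (𝓝 u) :=
    tendsto_iff_norm_sub_tendsto_zero.2
      (squeeze_zero (fun _ => norm_nonneg _) h1 hlim0)
  have hfn : Tendsto (fun n => fnL2 (φ n)) atTop (𝓝 (D.toFn u)) :=
    (D.fnCLM.continuous.tendsto u).comp hφ
  -- Both time derivatives are close to the same `ξ`, so the difference of two approximants has a
  -- small time derivative in `Y'` and a small norm in `Y`. The energy estimate gives `‖slice‖² ≤ 2
  -- η²`, uniformly in `t`, and `2 η² ≤ (2 η)²`.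
  have hdist : ∀ m n, ∀ t ∈ Icc 0 D.T, dist (slice t (φ m)) (slice t (φ n)) ≤
      2 * (1 / ((m : ℝ) + 1) + 1 / ((n : ℝ) + 1)) := by
    intro m n t ht
    set η : ℝ := 1 / ((m : ℝ) + 1) + 1 / ((n : ℝ) + 1) with hη
    have hη0 : 0 ≤ η := (add_pos (hε m) (hε n)).le
    have b1 : ∀ ψ : D.Y, |inner ℝ (dtL2 (φ m - φ n)) (D.toFn ψ)| ≤ η * ‖ψ‖ := fun ψ => by
      have e : inner ℝ (dtL2 (φ m - φ n)) (D.toFn ψ) =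
          (inner ℝ (dtL2 (φ m)) (D.toFn ψ) - ξ ψ) - (inner ℝ (dtL2 (φ n)) (D.toFn ψ) - ξ ψ) := by
        rw [map_sub, inner_sub_left]
        ring
      rw [e, hη, add_mul]
      exact (abs_sub _ _).trans (add_le_add (h2 m ψ) (h2 n ψ))
    have b2 : ‖toY (φ m - φ n)‖ ≤ η := by
      have e : toY (φ m - φ n) = (toY (φ m) - u) - (toY (φ n) - u) := by
        rw [map_sub]
        abel
      rw [e]
      exact (norm_sub_le _ _).trans (add_le_add (h1 m) (h1 n))
    have b3 := norm_slice_sq_le (θ := φ m - φ n)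
      (fun p hp => by
        change φ m p - φ n p = 0
        rw [h0 m p hp, h0 n p hp, sub_zero]) hη0 b1 ht
    rw [dist_eq_norm, ← map_sub]
    refine le_of_sq_le_sq (b3.trans ?_) (by positivity)
    have := mul_le_mul_of_nonneg_left b2 hη0
    nlinarith
  have hc : UniformCauchySeqOn (fun n t => slice t (φ n)) atTop (Icc 0 D.T) := by
    rw [Metric.uniformCauchySeqOn_iff]
    intro ε hε'
    obtain ⟨N, hN⟩ := (Metric.tendsto_atTop.1 hlim0) (ε / 4) (by positivity)
    refine ⟨N, fun m hm n hn t ht => (hdist m n t ht).trans_lt ?_⟩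
    have h3 := hN m hm
    have h4 := hN n hn
    rw [Real.dist_0_eq_abs, abs_of_pos (hε _)] at h3 h4
    linarith
  choose! w hw using fun t (ht : t ∈ Icc 0 D.T) =>
    cauchySeq_tendsto_of_complete (hc.cauchySeq ht)
  have hunif := hc.tendstoUniformlyOn_of_tendsto hw
  refine ⟨w, hunif.continuousOn (Frequently.of_forall fun n => (continuous_slice (φ n)).continuousOn),
    ae_eq_of_tendsto_slice hfn hw, ?_⟩
  have h5 : ∀ n, slice 0 (φ n) = 0 := fun n => by
    rw [← norm_eq_zero, ← sq_eq_zero_iff, norm_slice_sq]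
    simp [h0 n (_, 0) le_rfl]
  have h6 := hw 0 (left_mem_Icc.2 D.T_pos.le)
  simp only [h5] at h6
  exact tendsto_nhds_unique h6 tendsto_const_nhds

/-! ### Functions vanishing at the initial time -/

/-- A smooth monotone function which vanishes for `t ≤ 1/n` and is `1` for `t ≥ 2/n`. -/
def ramp (n : ℕ) (t : ℝ) : ℝ := Real.smoothTransition (n * t - 1)

theorem contDiff_ramp (n : ℕ) : ContDiff ℝ 1 (ramp n) :=
  (Real.smoothTransition.contDiff (n := 1)).comp (by fun_prop)

theorem abs_ramp_le (n : ℕ) (t : ℝ) : |ramp n t| ≤ 1 := by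
  rw [ramp, abs_of_nonneg (Real.smoothTransition.nonneg _)]
  exact Real.smoothTransition.le_one _

theorem monotone_ramp (n : ℕ) : Monotone (ramp n) := fun s t h =>
  Real.smoothTransition.monotone (by gcongr)

theorem ramp_eq_one {n : ℕ} {t : ℝ} (h : 2 ≤ n * t) : ramp n t = 1 :=
  Real.smoothTransition.one_of_one_le (by linarith)

theorem tendsto_ramp {t : ℝ} (ht : 0 < t) : Tendsto (fun n => ramp n t) atTop (𝓝 1) := by
  refine tendsto_const_nhds.congr' ?_
  obtain ⟨N, hN⟩ := exists_nat_ge (2 / t)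
  filter_upwards [eventually_ge_atTop N] with n hn
  have : 2 / t ≤ n := hN.trans (by exact_mod_cast hn)
  rw [div_le_iff₀ ht] at this
  exact (ramp_eq_one this).symm

theorem tsupport_ramp_subset (n : ℕ) : tsupport (ramp n) ⊆ Ioi 0 := by
  have h1 : tsupport (ramp n) ⊆ {t | 1 ≤ n * t} := by
    refine closure_minimal (fun t ht => ?_) (isClosed_le continuous_const (by fun_prop))
    by_contra hc
    exact ht (Real.smoothTransition.zero_of_nonpos (by
      have : ¬ 1 ≤ n * t := hc
      linarith [not_le.1 this]))
  refine h1.trans fun t ht => ?_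
  by_contra hc
  have h2 : (n : ℝ) * t ≤ 0 := mul_nonpos_of_nonneg_of_nonpos n.cast_nonneg (not_lt.1 hc)
  have h3 : 1 ≤ (n : ℝ) * t := ht
  linarith

theorem deriv_ramp_nonneg (n : ℕ) (t : ℝ) : 0 ≤ deriv (ramp n) t :=
  (monotone_ramp n).deriv_nonneg

theorem deriv_ramp_eq_zero {n : ℕ} {t : ℝ} (h : 2 < n * t) : deriv (ramp n) t = 0 := by
  have : ramp n =ᶠ[𝓝 t] fun _ => 1 := by
    filter_upwards [(isOpen_lt continuous_const (by fun_prop : Continuous fun s : ℝ => n * s)).mem_nhds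
      (show t ∈ {s : ℝ | 2 < n * s} from h)] with s hs
    exact ramp_eq_one (le_of_lt hs)
  rw [this.deriv_eq, deriv_const]

/-- The bound is uniform in `n`: the derivatives are nonnegative, of mass at most `1`, and
concentrate at time `0`. -/
theorem integral_deriv_ramp_le (n : ℕ) {T : ℝ} (hT : 0 ≤ T) :
    ∫ t in Ioo 0 T, deriv (ramp n) t ≤ 1 := by
  have hc : Continuous (deriv (ramp n)) := (contDiff_ramp n).continuous_deriv le_rfl
  rw [← integral_Ioc_eq_integral_Ioo, ← intervalIntegral.integral_of_le hT,
    intervalIntegral.integral_deriv_eq_sub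
      (fun t _ => (contDiff_ramp n).differentiable one_ne_zero t) (hc.intervalIntegrable _ _)]
  have h1 : ramp n T ≤ 1 := Real.smoothTransition.le_one _
  have h2 : 0 ≤ ramp n 0 := Real.smoothTransition.nonneg _
  linarith

theorem integrableOn_mul_of_hasCompactSupport (u : L2 (D.Q : Set (SpaceTime d)))
    {f : SpaceTime d → ℝ} (hf : Continuous f) (hc : HasCompactSupport f) :
    IntegrableOn (fun p => u p * f p) (D.Q : Set (SpaceTime d)) :=
  (Lp.memLp u).integrable_mul (memLp_of_hasCompactSupport hf hc)

/-- The contribution of a steep cutoff near time `0` is small. -/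
theorem tendsto_integral_deriv_ramp {u : D.Y}
    {w : ℝ → Lp ℝ 2 ((volume : Measure (Space d)).restrict (D.Ω : Set (Space d)))}
    (hw : ContinuousOn w (Icc 0 D.T))
    (huw : ∀ᵐ t ∂(volume : Measure ℝ).restrict (Ioo 0 D.T),
      (fun x => D.toFn u (x, t)) =ᵐ[volume.restrict (D.Ω : Set (Space d))] w t)
    (hw0 : w 0 = 0) (φ : D.Test) :
    Tendsto (fun n => ∫ p in (D.Q : Set (SpaceTime d)),
      D.toFn u p * (deriv (ramp n) p.2 * φ p)) atTop (𝓝 0) := by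
  obtain ⟨C, hC0, hC⟩ := exists_norm_slice_le φ
  rw [Metric.tendsto_atTop]
  intro ε hε
  -- For `t < δ` the slice `w t` is small relative to the bound `C` for the slices of `φ`; `C + 1`
  -- avoids division by zero.
  obtain ⟨δ, hδ, hwδ⟩ := Metric.continuousWithinAt_iff.1 (hw 0 (left_mem_Icc.2 D.T_pos.le))
    (ε / (2 * (C + 1))) (by positivity)
  -- For `n > 2 / δ` the derivative of the ramp vanishes at all times `t ≥ δ`.
  obtain ⟨N, hN⟩ := exists_nat_gt (2 / δ)
  refine ⟨N, fun n hn => ?_⟩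
  have hnδ : 2 < n * δ := by
    have : 2 / δ < n := hN.trans_le (by exact_mod_cast hn)
    rwa [div_lt_iff₀ hδ] at this
  have hdc : Continuous (deriv (ramp n)) := (contDiff_ramp n).continuous_deriv le_rfl
  have hint := integrableOn_mul_of_hasCompactSupport (D.toFn u)
    (f := fun p => deriv (ramp n) p.2 * φ p) ((hdc.comp continuous_snd).mul φ.continuous)
    φ.hasCompactSupport.mul_left
  rw [integral_Q_eq hint, dist_zero_right]
  have hbound : ∀ᵐ t ∂(volume : Measure ℝ).restrict (Ioo 0 D.T),
      ‖∫ x in (D.Ω : Set (Space d)), D.toFn u (x, t) * (deriv (ramp n) t * φ (x, t))‖ ≤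
        deriv (ramp n) t * (ε / 2) := by
    filter_upwards [huw, self_mem_ae_restrict measurableSet_Ioo] with t ht hmem
    have e : ∫ x in (D.Ω : Set (Space d)), D.toFn u (x, t) * (deriv (ramp n) t * φ (x, t)) =
        deriv (ramp n) t * inner ℝ (w t) (slice t φ) := by
      rw [show inner ℝ (w t) (slice t φ) = _ from inner_toLp_right (w t) (memLp_slice t φ),
        ← integral_const_mul]
      refine integral_congr_ae ?_
      filter_upwards [ht] with x hx
      rw [hx]
      change _ = deriv (ramp n) t * (φ (x, t) * w t x)
      ring
    rw [e, norm_mul, Real.norm_eq_abs, abs_of_nonneg (deriv_ramp_nonneg n t)]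
    by_cases htδ : t < δ
    · refine mul_le_mul_of_nonneg_left ?_ (deriv_ramp_nonneg n t)
      refine (norm_inner_le_norm _ _).trans ?_
      have h1 := hwδ (Ioo_subset_Icc_self hmem) (by
        rw [Real.dist_0_eq_abs, abs_of_pos hmem.1]
        exact htδ)
      rw [hw0, dist_zero_right] at h1
      calc ‖w t‖ * ‖slice t φ‖ ≤ ε / (2 * (C + 1)) * (C + 1) := by
            gcongr
            exact (hC t).trans (by linarith)
        _ = ε / 2 := by field_simp
    · have h2 : 2 < n * t := hnδ.trans_le (by gcongr; exact not_lt.1 htδ)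
      simp [deriv_ramp_eq_zero h2]
  have hi : Integrable (fun t => deriv (ramp n) t * (ε / 2))
      ((volume : Measure ℝ).restrict (Ioo 0 D.T)) :=
    ((hdc.integrableOn_Icc (a := 0) (b := D.T)).mono_set Ioo_subset_Icc_self).mul_const _
  refine (norm_integral_le_of_norm_le hi hbound).trans_lt ?_
  rw [integral_mul_const]
  have := mul_le_mul_of_nonneg_right (integral_deriv_ramp_le n D.T_pos.le) (half_pos hε).le
  linarith

/-- The initial value is captured by testing with functions that do not vanish at time `0`. -/
theorem hasTimeDerivFromZero_of_continuousOn {u : D.Y} {ξ : StrongDual ℝ D.Y}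
    (hξ : D.HasTimeDeriv u ξ)
    {w : ℝ → Lp ℝ 2 ((volume : Measure (Space d)).restrict (D.Ω : Set (Space d)))}
    (hw : ContinuousOn w (Icc 0 D.T))
    (huw : ∀ᵐ t ∂(volume : Measure ℝ).restrict (Ioo 0 D.T),
      (fun x => D.toFn u (x, t)) =ᵐ[volume.restrict (D.Ω : Set (Space d))] w t)
    (hw0 : w 0 = 0) : HasTimeDerivFromZero u ξ := by
  intro φ hφT
  have hcd := continuous_timeDiff (contDiff_test φ)
  have hcs := hasCompactSupport_timeDiff (contDiff_test φ) φ.hasCompactSupport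
  have hφ := tendsto_toY_mulTime contDiff_ramp φ abs_ramp_le fun t ht => tendsto_ramp ht.1
  have h1 := (ξ.continuous.tendsto _).comp hφ
  have hrm : ∀ n, MemLp (fun p : SpaceTime d => ramp n p.2 * timeDiff φ p) 2
      (volume.restrict (D.Q : Set (SpaceTime d))) := fun n =>
    memLp_of_hasCompactSupport (((contDiff_ramp n).continuous.comp continuous_snd).mul hcd)
      hcs.mul_left
  have h2 : Tendsto (fun n => (hrm n).toLp _) atTop (𝓝 (dtL2 φ)) :=
    tendsto_toLp_mulTime (f := timeDiff φ) hcd hcs (fun n p => rfl) hrm (memLp_timeDiff φ)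
      abs_ramp_le fun t ht => tendsto_ramp ht.1
  have h3 := tendsto_integral_deriv_ramp hw huw hw0 φ
  -- The product of the ramp with `φ` is supported in `Q_T` and hence admissible in `hξ`. The
  -- product rule splits off a term concentrated at time `0`, which tends to zero by `h3`.
  have key : ∀ n, ξ (toY (mulTime (ramp n) (contDiff_ramp n) φ)) =
      -((∫ p in (D.Q : Set (SpaceTime d)), D.toFn u p * (deriv (ramp n) p.2 * φ p)) +
        inner ℝ (D.toFn u) ((hrm n).toLp _)) := by
    intro n
    have hq := hξ (toQ (mulTime (ramp n) (contDiff_ramp n) φ) fun p hp =>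
      ⟨tsupport_ramp_subset n (tsupport_mulTime_subset _ _ φ hp).2,
        hφT p (tsupport_mulTime_subset _ _ φ hp).1⟩)
    refine hq.trans (congrArg Neg.neg ?_)
    have hdc : Continuous (deriv (ramp n)) := (contDiff_ramp n).continuous_deriv le_rfl
    have i1 := integrableOn_mul_of_hasCompactSupport (D.toFn u)
      (f := fun p => deriv (ramp n) p.2 * φ p) ((hdc.comp continuous_snd).mul φ.continuous)
      φ.hasCompactSupport.mul_left
    have i2 := integrableOn_mul_of_hasCompactSupport (D.toFn u)
      (f := fun p => ramp n p.2 * timeDiff φ p)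
      (((contDiff_ramp n).continuous.comp continuous_snd).mul hcd) hcs.mul_left
    rw [inner_toLp_right]
    have e : ∀ p : SpaceTime d, inner ℝ (D.toFn u p) (ramp n p.2 * timeDiff φ p) =
        D.toFn u p * (ramp n p.2 * timeDiff φ p) := fun p => mul_comm _ _
    simp only [e]
    rw [← integral_add i1 i2]
    congr 1 with p
    rw [← mul_add]
    exact congrArg _ (timeDiff_mul_time (contDiff_test φ) (contDiff_ramp n) p)
  have h4 : Tendsto (fun n => ξ (toY (mulTime (ramp n) (contDiff_ramp n) φ))) atTop
      (𝓝 (-(0 + inner ℝ (D.toFn u) (dtL2 φ)))) := by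
    simp only [key]
    exact (h3.add (tendsto_const_nhds.inner h2)).neg
  rw [zero_add] at h4
  exact tendsto_nhds_unique h1 h4

end MovingDomain

/-! ### Abstract functional analysis -/

/-- Lions' projection theorem: a linear functional dominated by `‖A m‖` is represented by an inner
product with `A m`. -/
theorem exists_inner_eq_of_bound {M V : Type*} [AddCommGroup M] [Module ℝ M]
    [NormedAddCommGroup V] [InnerProductSpace ℝ V] [CompleteSpace V] (A : M →ₗ[ℝ] V)
    (l : M →ₗ[ℝ] ℝ) (C : ℝ) (h : ∀ m, |l m| ≤ C * ‖A m‖) :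
    ∃ u : V, ∀ m, inner ℝ u (A m) = l m := by
  let K : Submodule ℝ V := (LinearMap.range A).topologicalClosure
  have hK : IsClosed (K : Set V) := Submodule.isClosed_topologicalClosure _
  have : CompleteSpace K := hK.completeSpace_coe
  let e : M →ₗ[ℝ] K := A.codRestrict K fun m =>
    Submodule.le_topologicalClosure _ (LinearMap.mem_range_self A m)
  have he : DenseRange e := by
    intro y
    rw [closure_subtype]
    refine closure_mono ?_ (show (y : V) ∈ closure (LinearMap.range A : Set V) from y.2)
    rintro _ ⟨m, rfl⟩
    exact ⟨e m, ⟨m, rfl⟩, rfl⟩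
  -- The bound `h` makes `l` depend on `A m` only, so it descends to the range of `A` and extends to
  -- the closure `K`, where Riesz's theorem applies.
  let f : K →L[ℝ] ℝ := l.extendOfNorm e
  have hf : ∀ m, f (e m) = l m := fun m => LinearMap.extendOfNorm_eq he ⟨C, h⟩ m
  refine ⟨((InnerProductSpace.toDual ℝ K).symm f : K), fun m => ?_⟩
  rw [← hf m, ← InnerProductSpace.toDual_symm_apply (𝕜 := ℝ) (x := e m) (y := f)]
  rfl

/-- The Tikhonov functional of a bounded linear operator has a unique minimizer over a nonempty
closed convex set. -/
theorem existsUnique_isMinOn_tikhonov {H Z : Type*} [NormedAddCommGroup H] [InnerProductSpace ℝ H]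
    [CompleteSpace H] [NormedAddCommGroup Z] [InnerProductSpace ℝ Z]
    (K : H →L[ℝ] Z) (z : Z) {lam : ℝ} (hlam : 0 < lam) {C : Set H} (hne : C.Nonempty)
    (hcl : IsClosed C) (hconv : Convex ℝ C) :
    ∃! f, f ∈ C ∧ IsMinOn (fun f => 1 / 2 * ‖K f - z‖ ^ 2 + lam / 2 * ‖f‖ ^ 2) C f := by
  -- With `J f = (K f, √lam f)` and `w = (z, 0)` the functional is `½ ‖w - J f‖²`, so minimizing it
  -- means finding the point of `J '' C` nearest to `w`.
  let J : H →L[ℝ] WithLp 2 (Z × H) :=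
    ((WithLp.prodContinuousLinearEquiv 2 ℝ Z H).symm : (Z × H) →L[ℝ] WithLp 2 (Z × H)).comp
      (K.prod (Real.sqrt lam • ContinuousLinearMap.id ℝ H))
  let w : WithLp 2 (Z × H) := WithLp.toLp 2 (z, 0)
  have hI : ∀ f, 1 / 2 * ‖K f - z‖ ^ 2 + lam / 2 * ‖f‖ ^ 2 = 1 / 2 * ‖w - J f‖ ^ 2 := fun f => by
    rw [WithLp.prod_norm_sq_eq_of_L2]
    change _ = 1 / 2 * (‖z - K f‖ ^ 2 + ‖0 - Real.sqrt lam • f‖ ^ 2)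
    rw [zero_sub, norm_neg, norm_smul, mul_pow, Real.norm_eq_abs, sq_abs, Real.sq_sqrt hlam.le,
      norm_sub_rev]
    ring
  have hJ : ∀ f, Real.sqrt lam * ‖f‖ ≤ ‖J f‖ := fun f => by
    refine le_of_sq_le_sq ?_ (norm_nonneg _)
    rw [WithLp.prod_norm_sq_eq_of_L2]
    change _ ≤ ‖K f‖ ^ 2 + ‖Real.sqrt lam • f‖ ^ 2
    rw [norm_smul, Real.norm_eq_abs, abs_of_nonneg (Real.sqrt_nonneg _)]
    nlinarith [sq_nonneg ‖K f‖]
  have hs : 0 < Real.sqrt lam := Real.sqrt_pos.2 hlam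
  -- The second component bounds `J` from below, which makes `J '' C` complete and `J` injective.
  have hanti : AntilipschitzWith (Real.toNNReal (Real.sqrt lam)⁻¹) J := by
    refine J.antilipschitz_of_bound fun f => ?_
    rw [Real.coe_toNNReal _ (inv_nonneg.2 hs.le), ← div_eq_inv_mul, le_div_iff₀ hs, mul_comm]
    exact hJ f
  have hcomp : IsComplete (J '' C) :=
    (hanti.isUniformInducing J.uniformContinuous).isComplete_iff.2 hcl.isComplete
  obtain ⟨_, ⟨f, hfC, rfl⟩, hf⟩ := exists_norm_eq_iInf_of_complete_convex (hne.image J) hcomp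
    (hconv.linear_image (J : H →ₗ[ℝ] WithLp 2 (Z × H))) w
  have hmin : ∀ g ∈ C, ‖w - J f‖ ≤ ‖w - J g‖ := fun g hg => by
    rw [hf]
    exact ciInf_le ⟨0, forall_mem_range.2 fun _ => norm_nonneg _⟩
      (⟨J g, mem_image_of_mem J hg⟩ : (J '' C : Set (WithLp 2 (Z × H))))
  refine ⟨f, ⟨hfC, fun g hg => ?_⟩, ?_⟩
  · change 1 / 2 * ‖K f - z‖ ^ 2 + lam / 2 * ‖f‖ ^ 2 ≤ 1 / 2 * ‖K g - z‖ ^ 2 + lam / 2 * ‖g‖ ^ 2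
    rw [hI, hI]
    have := hmin g hg
    gcongr
  · rintro g ⟨hgC, hg⟩
    have h1 : 1 / 2 * ‖w - J g‖ ^ 2 ≤ 1 / 2 * ‖w - J f‖ ^ 2 := by
      rw [← hI, ← hI]
      exact hg hfC
    -- Uniqueness: the midpoint of two minimizers lies in `C`, and the parallelogram law forces `J f
    -- = J g`.
    have hm : (1 / 2 : ℝ) • f + (1 / 2 : ℝ) • g ∈ C :=
      hconv hfC hgC (by norm_num) (by norm_num) (by norm_num)
    have h2 := hmin _ hm
    have e1 : w - J ((1 / 2 : ℝ) • f + (1 / 2 : ℝ) • g) =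
        (1 / 2 : ℝ) • ((w - J f) + (w - J g)) := by
      rw [map_add, map_smul, map_smul]
      module
    rw [e1, norm_smul, Real.norm_of_nonneg (by norm_num)] at h2
    have h3 := parallelogram_law_with_norm ℝ (w - J f) (w - J g)
    rw [sub_sub_sub_cancel_left, ← map_sub] at h3
    have h4 : ‖w - J f‖ ^ 2 ≤ (1 / 2 * ‖w - J f + (w - J g)‖) ^ 2 :=
      pow_le_pow_left₀ (norm_nonneg _) h2 2
    have h5 : ‖J (g - f)‖ = 0 := by
      have : ‖J (g - f)‖ ^ 2 ≤ 0 := by nlinarith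
      exact sq_eq_zero_iff.1 (le_antisymm this (sq_nonneg _))
    have h6 := hJ (g - f)
    rw [h5] at h6
    have h7 : ‖g - f‖ = 0 :=
      le_antisymm (nonpos_of_mul_nonpos_right h6 hs) (norm_nonneg _)
    exact sub_eq_zero.1 (norm_eq_zero.1 h7)

namespace MovingDomain

variable {d : ℕ} {D : MovingDomain d}

/-! ### Weak solutions -/

variable (D) in
/-- The functional `φ ↦ (F, φ) - ∫ (v · ∇u) φ + κ ∇u · ∇φ`, which is the time derivative of a
weak solution. -/
def residual (κ₁ κ₂ : ℝ) (F : L2 (D.Q : Set (SpaceTime d))) (u : D.Y) : StrongDual ℝ D.Y :=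
  (innerSL ℝ F).comp D.fnCLM - D.spaceForm κ₁ κ₂ u

theorem residual_apply (κ₁ κ₂ : ℝ) (F : L2 (D.Q : Set (SpaceTime d))) (u φ : D.Y) :
    D.residual κ₁ κ₂ F u φ = inner ℝ F (D.toFn φ) - D.spaceForm κ₁ κ₂ u φ := rfl

/-- `u ∈ Y` solves the weak problem with source `F` and vanishing initial value. -/
def Solves (κ₁ κ₂ : ℝ) (F : L2 (D.Q : Set (SpaceTime d))) (u : D.Y) : Prop :=
  HasTimeDerivFromZero u (D.residual κ₁ κ₂ F u)

/-- The equation identifies the time derivative as `residual`, and with that derivative the initial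
condition is equivalent to allowing tests that do not vanish at time `0`. Uniqueness of the time
derivative matches the chosen `dt u` with `residual`. -/
theorem isWeakSolution_iff (κ₁ κ₂ : ℝ) (F : L2 (D.Q : Set (SpaceTime d))) (u : D.X) :
    D.IsWeakSolution κ₁ κ₂ F u ↔ Solves κ₁ κ₂ F u.1 := by
  constructor
  · rintro ⟨⟨w, hw, huw, hw0⟩, h⟩
    have e : D.dt u = D.residual κ₁ κ₂ F u.1 := by
      ext φ
      rw [residual_apply, ← h φ, form_eq]
      ring
    rw [Solves, ← e]
    exact hasTimeDerivFromZero_of_continuousOn (D.hasTimeDeriv_dt u) hw huw hw0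
  · intro h
    have e : D.dt u = D.residual κ₁ κ₂ F u.1 :=
      HasTimeDeriv.unique D (D.hasTimeDeriv_dt u) h.hasTimeDeriv
    refine ⟨h.exists_continuousOn, fun φ => ?_⟩
    rw [form_eq, e, residual_apply]
    ring

theorem Solves.add {κ₁ κ₂ : ℝ} {F G : L2 (D.Q : Set (SpaceTime d))} {u v : D.Y}
    (hu : Solves κ₁ κ₂ F u) (hv : Solves κ₁ κ₂ G v) : Solves κ₁ κ₂ (F + G) (u + v) := by
  intro φ hφ
  have h1 := hu φ hφ
  have h2 := hv φ hφ
  have e : D.toFn (u + v) = D.toFn u + D.toFn v := D.fnCLM.map_add u v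
  rw [residual_apply] at h1 h2 ⊢
  rw [e, inner_add_left, inner_add_left, map_add, add_apply]
  linarith

theorem Solves.smul {κ₁ κ₂ : ℝ} {F : L2 (D.Q : Set (SpaceTime d))} {u : D.Y}
    (hu : Solves κ₁ κ₂ F u) (c : ℝ) : Solves κ₁ κ₂ (c • F) (c • u) := by
  intro φ hφ
  have h1 := hu φ hφ
  have e : D.toFn (c • u) = c • D.toFn u := D.fnCLM.map_smul c u
  rw [residual_apply] at h1 ⊢
  rw [e, real_inner_smul_left, real_inner_smul_left, map_smul, smul_apply,
    smul_eq_mul, ← mul_sub, h1, mul_neg]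

/-- Testing with `u` itself: `0 ≤ ⟨∂ₜu, u⟩ = (F, u) - B(u, u)`, and coercivity bounds `B(u, u)` from
below. -/
theorem Solves.norm_le {κ₁ κ₂ c : ℝ} (hc : 0 < c)
    (hcoer : ∀ u : D.Y, c * ‖u‖ ^ 2 ≤ D.spaceForm κ₁ κ₂ u u)
    {F : L2 (D.Q : Set (SpaceTime d))} {u : D.Y} (hu : Solves κ₁ κ₂ F u) :
    ‖u‖ ≤ c⁻¹ * ‖F‖ := by
  have h1 := hu.apply_self_nonneg
  rw [residual_apply] at h1
  have h2 := hcoer u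
  have h3 : inner ℝ F (D.toFn u) ≤ ‖F‖ * ‖u‖ :=
    (real_inner_le_norm _ _).trans (mul_le_mul_of_nonneg_left (norm_toFn_le u) (norm_nonneg _))
  rw [← div_eq_inv_mul, le_div_iff₀ hc]
  by_cases hz : ‖u‖ = 0
  · rw [hz, zero_mul]
    exact norm_nonneg _
  · have hpos : 0 < ‖u‖ := lt_of_le_of_ne (norm_nonneg _) (Ne.symm hz)
    nlinarith

theorem Solves.unique {κ₁ κ₂ c : ℝ} (hc : 0 < c)
    (hcoer : ∀ u : D.Y, c * ‖u‖ ^ 2 ≤ D.spaceForm κ₁ κ₂ u u)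
    {F : L2 (D.Q : Set (SpaceTime d))} {u v : D.Y} (hu : Solves κ₁ κ₂ F u)
    (hv : Solves κ₁ κ₂ F v) : u = v := by
  have h := (hu.add (hv.smul (-1))).norm_le hc hcoer
  rw [neg_one_smul, neg_one_smul, add_neg_cancel, norm_zero, mul_zero] at h
  exact add_neg_eq_zero.1 (norm_eq_zero.1 (le_antisymm h (norm_nonneg _)))

variable (D) in
/-- The cylinder `Ω × (-∞, T)`. -/
def pastCylinder : TopologicalSpace.Opens (SpaceTime d) :=
  ⟨(D.Ω : Set (Space d)) ×ˢ Iio D.T, D.Ω.isOpen.prod isOpen_Iio⟩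

/-- Test functions on `Ω × (-∞, T)` as test functions on `Ω × ℝ`. -/
abbrev ofPast : 𝓓^{1}(D.pastCylinder, ℝ) →ₗ[ℝ] D.Test := extend fun _ hp => hp.1

/-- The adjoint of the parabolic operator, represented in `Y`; this is the operator to which Lions'
theorem is applied. -/
theorem exists_inner_eq_spaceForm_sub (κ₁ κ₂ : ℝ) :
    ∃ A : 𝓓^{1}(D.pastCylinder, ℝ) →ₗ[ℝ] D.Y, ∀ (u : D.Y) φ, inner ℝ u (A φ) =
      D.spaceForm κ₁ κ₂ u (toY (ofPast φ)) - inner ℝ (D.toFn u) (dtL2 (ofPast φ)) := by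
  obtain ⟨B, hB⟩ : ∃ B : D.Y →L[ℝ] D.Y, ∀ u φ : D.Y,
      inner ℝ u (B φ) = D.spaceForm κ₁ κ₂ u φ := by
    refine ⟨D.transport.adjoint.comp D.fnCLM + (D.flux κ₁ κ₂).adjoint.comp D.gradCLM,
      fun u φ => ?_⟩
    have h1 := ContinuousLinearMap.adjoint_inner_right D.transport u (D.fnCLM φ)
    have h2 := ContinuousLinearMap.adjoint_inner_right (D.flux κ₁ κ₂) u (D.gradCLM φ)
    rw [spaceForm_apply]
    exact (inner_add_right u (D.transport.adjoint (D.fnCLM φ))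
      ((D.flux κ₁ κ₂).adjoint (D.gradCLM φ))).trans (congrArg₂ (· + ·) h1 h2)
  refine ⟨((B : D.Y →ₗ[ℝ] D.Y) ∘ₗ toY -
    (D.fnCLM.adjoint : L2 (D.Q : Set (SpaceTime d)) →ₗ[ℝ] D.Y) ∘ₗ dtL2) ∘ₗ ofPast, fun u φ => ?_⟩
  have h := ContinuousLinearMap.adjoint_inner_right D.fnCLM u (dtL2 (ofPast φ))
  exact (inner_sub_right u (B (toY (ofPast φ))) (D.fnCLM.adjoint (dtL2 (ofPast φ)))).trans
    (congrArg₂ (· - ·) (hB u _) h)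

/-- Testing the adjoint with `φ` gives `c ‖φ‖² ≤ B(φ, φ) - (φ, ∂ₜφ) = (φ, A φ)`, so `‖φ‖ ≤ c⁻¹ ‖A
φ‖`. The functional `φ ↦ (F, φ)` is thus dominated by `‖A φ‖`, and Lions' theorem yields `u`. -/
theorem exists_solves {κ₁ κ₂ c : ℝ} (hc : 0 < c)
    (hcoer : ∀ u : D.Y, c * ‖u‖ ^ 2 ≤ D.spaceForm κ₁ κ₂ u u)
    (F : L2 (D.Q : Set (SpaceTime d))) : ∃ u : D.Y, Solves κ₁ κ₂ F u := by
  obtain ⟨A, hA⟩ := exists_inner_eq_spaceForm_sub (D := D) κ₁ κ₂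
  obtain ⟨l, hl⟩ : ∃ l : 𝓓^{1}(D.pastCylinder, ℝ) →ₗ[ℝ] ℝ,
      ∀ φ, l φ = inner ℝ F (fnL2 (ofPast φ)) :=
    ⟨(innerSL ℝ F : L2 (D.Q : Set (SpaceTime d)) →ₗ[ℝ] ℝ) ∘ₗ fnL2 ∘ₗ ofPast, fun _ => rfl⟩
  have hbound : ∀ φ, |l φ| ≤ ‖F‖ * c⁻¹ * ‖A φ‖ := by
    intro φ
    set y := toY (ofPast φ) with hy
    have h1 : c * ‖y‖ ^ 2 ≤ ‖y‖ * ‖A φ‖ := by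
      refine (hcoer y).trans (le_trans ?_ (real_inner_le_norm _ _))
      rw [hA]
      have := inner_dtL2_self_nonpos (φ := ofPast φ) fun p hp => (φ.tsupport_subset hp).2
      rw [toFn_toY]
      linarith
    have h2 : ‖y‖ ≤ c⁻¹ * ‖A φ‖ := by
      rw [← div_eq_inv_mul, le_div_iff₀ hc]
      by_cases hz : ‖y‖ = 0
      · rw [hz, zero_mul]
        exact norm_nonneg _
      · have hpos : 0 < ‖y‖ := lt_of_le_of_ne (norm_nonneg _) (Ne.symm hz)
        nlinarith
    rw [hl, mul_assoc]
    refine (abs_real_inner_le_norm F (fnL2 (ofPast φ))).trans ?_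
    exact mul_le_mul_of_nonneg_left ((norm_toFn_le y).trans h2) (norm_nonneg _)
  obtain ⟨u, hu⟩ := exists_inner_eq_of_bound A l _ hbound
  refine ⟨u, fun φ hφ => ?_⟩
  let ψ : 𝓓^{1}(D.pastCylinder, ℝ) :=
    ⟨φ, φ.contDiff, φ.hasCompactSupport, fun p hp => ⟨fst_mem_of_mem_tsupport φ hp, hφ p hp⟩⟩
  have h1 : D.spaceForm κ₁ κ₂ u (toY φ) - inner ℝ (D.toFn u) (dtL2 φ) = inner ℝ F (fnL2 φ) :=
    (hA u ψ).symm.trans ((hu ψ).trans (hl ψ))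
  rw [residual_apply, toFn_toY]
  linarith

variable (D) in
/-- The weak problem is uniquely solvable, with a bounded linear solution operator. -/
theorem exists_solutionOperator (hd : 0 < d) {κ₁ κ₂ : ℝ} (hκ₁ : 0 < κ₁) (hκ₂ : 0 < κ₂) :
    ∃ R : L2 (D.Q : Set (SpaceTime d)) →L[ℝ] D.Y, ∀ F u, Solves κ₁ κ₂ F u ↔ u = R F := by
  obtain ⟨c, hc, hcoer⟩ := D.exists_coercive hd hκ₁ hκ₂
  choose R hR using exists_solves (D := D) hc hcoer
  let R' : L2 (D.Q : Set (SpaceTime d)) →ₗ[ℝ] D.Y :=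
    -- Solutions superpose, so uniqueness makes the chosen solution map linear; the a priori
    -- estimate makes it bounded.
    { toFun := R
      map_add' := fun F G => (hR (F + G)).unique hc hcoer ((hR F).add (hR G))
      map_smul' := fun r F => (hR (r • F)).unique hc hcoer ((hR F).smul r) }
  refine ⟨R'.mkContinuous c⁻¹ fun F => (hR F).norm_le hc hcoer, fun F u =>
    ⟨fun h => h.unique hc hcoer (hR F), ?_⟩⟩
  rintro rfl
  exact hR F

/-! ### Observation and admissible sources -/

/-- Restriction to a smaller set as a bounded linear operator. -/
def restrictCLM {A B : Set (SpaceTime d)} (h : A ⊆ B) : L2 B →L[ℝ] L2 A :=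
  LinearMap.mkContinuous
    { toFun := restrictL2 h
      map_add' := fun u v => by
        rw [restrictL2, restrictL2, restrictL2, ← MemLp.toLp_add]
        exact MemLp.toLp_congr _ _ (ae_mono (Measure.restrict_mono h le_rfl) (Lp.coeFn_add u v))
      map_smul' := fun c u => by
        rw [restrictL2, restrictL2, RingHom.id_apply, ← MemLp.toLp_const_smul]
        exact MemLp.toLp_congr _ _ (ae_mono (Measure.restrict_mono h le_rfl) (Lp.coeFn_smul c u)) }
    1 fun u => by
      rw [one_mul]
      change ‖restrictL2 h u‖ ≤ ‖u‖
      rw [restrictL2, Lp.norm_toLp, Lp.norm_def]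
      exact ENNReal.toReal_mono (Lp.eLpNorm_ne_top u)
        (eLpNorm_mono_measure _ (Measure.restrict_mono h le_rfl))

variable (D) in
-- As an order interval the admissible set is closed, because the order of `L²` is closed.
theorem admissible_eq : D.admissible = Ici 0 := by
  ext f
  exact Lp.coeFn_nonneg f

variable (D) in
theorem isClosed_admissible : IsClosed D.admissible := by
  rw [admissible_eq]
  exact isClosed_Ici

variable (D) in
theorem convex_admissible : Convex ℝ D.admissible := by
  intro f hf g hg a b ha hb _
  filter_upwards [hf, hg, Lp.coeFn_add (a • f) (b • g), Lp.coeFn_smul a f, Lp.coeFn_smul b g]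
    with p h1 h2 h3 h4 h5
  rw [h3, Pi.add_apply, h4, h5]
  exact add_nonneg (mul_nonneg ha h1) (mul_nonneg hb h2)

variable (D) in
theorem zero_mem_admissible : 0 ∈ D.admissible := by
  rw [admissible_eq]
  exact self_mem_Ici

end MovingDomain

end AdvDiff

end

/-! ### The solution operator and the Tikhonov problem. -/

theorem mainTheorem9 {d : ℕ} (hd : d = 1 ∨ d = 2) (D : AdvDiff.MovingDomain d)
    (κ₁ κ₂ : ℝ) (hκ₁ : 0 < κ₁) (hκ₂ : 0 < κ₂)
    (ℓ : Lp ℝ ∞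
      ((volume : Measure (AdvDiff.SpaceTime d)).restrict (D.Q : Set (AdvDiff.SpaceTime d))))
    (L : ℝ) (hL : 0 < L)
    (hℓ : ∀ᵐ p ∂(volume : Measure (AdvDiff.SpaceTime d)).restrict
      (D.Q : Set (AdvDiff.SpaceTime d)), L ≤ ℓ p)
    (g : AdvDiff.L2 (D.Q : Set (AdvDiff.SpaceTime d)))
    (hg : ∀ᵐ p ∂(volume : Measure (AdvDiff.SpaceTime d)).restrict
      (D.Q : Set (AdvDiff.SpaceTime d)), 0 ≤ g p)
    (Ud Uε : AdvDiff.L2 D.ωT) (ε : ℝ) (hε : 0 < ε) (hnoise : ‖Uε - Ud‖ ≤ ε) :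
    ∃ S : AdvDiff.L2 (D.Q : Set (AdvDiff.SpaceTime d)) → D.X,
      (∀ F u, D.IsWeakSolution κ₁ κ₂ F u ↔ u = S F) ∧
      ∀ lam : ℝ, 0 < lam →
        ∃! f, f ∈ D.admissible ∧
          IsMinOn (D.tikhonov S ℓ (Uε - D.observe (S g)) lam) D.admissible f := by
  obtain ⟨R, hR⟩ := D.exists_solutionOperator (by omega) hκ₁ hκ₂
  -- The residual of `R F` is a time derivative in `Y'`, which places `R F` in `X`.
  let S : AdvDiff.L2 (D.Q : Set (AdvDiff.SpaceTime d)) → D.X := fun F =>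
    ⟨R F, _, ((hR F (R F)).2 rfl).hasTimeDeriv⟩
  refine ⟨S, fun F u => ?_, fun lam hlam => ?_⟩
  · rw [AdvDiff.MovingDomain.isWeakSolution_iff, hR]
    exact ⟨fun h => Subtype.ext h, fun h => congrArg Subtype.val h⟩
  -- The map `f ↦ u(f)|_{ω_T}` is a composition of bounded operators: multiplication by `ℓ ∈ L^∞`,
  -- solution, passage to `L²(Q_T)` and restriction. The Tikhonov functional then agrees
  -- definitionally with the abstract one.
  · let K : AdvDiff.L2 (D.Q : Set (AdvDiff.SpaceTime d)) →L[ℝ] AdvDiff.L2 D.ωT :=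
      (AdvDiff.MovingDomain.restrictCLM D.ωT_subset).comp (D.fnCLM.comp (R.comp
        ((ContinuousLinearMap.lsmul ℝ ℝ).holderL
          (volume.restrict (D.Q : Set (AdvDiff.SpaceTime d))) ∞ 2 2 ℓ)))
    exact AdvDiff.existsUnique_isMinOn_tikhonov K (Uε - D.observe (S g)) hlam
      ⟨0, D.zero_mem_admissible⟩ D.isClosed_admissible D.convex_admissible
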